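/- Theorem. Let $\mathcal H$ be a complex Hilbert space, $\mathcal D\subset\mathcal H$ a dense linear subspace, $I\subset\mathbb R$ an interval, $H_1,\dots,H_n$ symmetric operators with domain $\mathcal D$, and $f_1,\dots,f_n: I\to\mathbb R$ functions. For $t\in I$ put $$H(t)=\sum_{i=1}^n f_i(t)H_i,\qquad \operatorname{dom}H(t)=\mathcal D .$$ Assume that (i) $H(t)$ is self-adjoint for every $t\in I$; (ii) $f_i\in C^1(I)$ for every $i$; (iii) for every $i$ there is $K>0$, not depending on $t$, such that $\|H_i\Psi\|\le K(\|H(t)\Psi\|+\|\Psi\|)$ for all $\Psi\in\mathcal D$ and all $t\in I$. Then there is a strongly differentiable unitary propagator $U(t,s)$, $s,t\in I$, such that for every $s\in I$ and every $\Psi_s\in\mathcal D$ the curve $\Psi(t)=U(t,s)\Psi_s$ lies in $\mathcal D$ for all $t\in I$ and satisfies $$\frac{d}{dt}\Psi(t)=-iH(t)\Psi(t)\quad(t\in I),\qquad \Psi(s)=\Psi_s .$$ Here a unitary propagator is a family of unitary operators $U(t,s)$ on $\mathcal H$, $t,s\in I$, with $U(r,s)U(s,t)=U(r,t)$ and $U(t,t)=\mathrm{Id}$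 for all $r,s,t\in I$, and such that $(t,s)\mapsto U(t,s)\Phi$ is continuous on $I\times I$ for every $\Phi\in\mathcal H$. It is strongly differentiable if $(t,s)\mapsto U(t,s)\Phi$ is norm-differentiable on $I\times I$ for every $\Phi\in\mathcal D$. Derivatives at endpoints belonging to $I$ are one-sided (relative to $I$). -/

import Mathlib

/-- The operator `H(t) = ∑ i, f i t • H i` with domain `dom H(t) = D`, as an unbounded operator. -/
noncomputable def linearCombinationHamiltonian {ℋ : Type*} [NormedAddCommGroup ℋ]
    [InnerProductSpace ℂ ℋ] {n : ℕ} (D : Submodule ℂ ℋ) (H : Fin n → D →ₗ[ℂ] ℋ)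
    (f : Fin n → ℝ → ℝ) (t : ℝ) : ℋ →ₗ.[ℂ] ℋ where
  domain := D
  toFun := ∑ i, ((f i t : ℝ) : ℂ) • H i

/-- A densely defined operator `A` with domain `D` is symmetric if `⟪A x, y⟫ = ⟪x, A y⟫` for all
`x y ∈ D`. -/
def IsSymmetricOperatorOn {ℋ : Type*} [NormedAddCommGroup ℋ] [InnerProductSpace ℂ ℋ]
    (D : Submodule ℂ ℋ) (A : D →ₗ[ℂ] ℋ) : Prop :=
  Dense (D : Set ℋ) ∧ ∀ x y : D, inner ℂ (A x) (y : ℋ) = inner ℂ (x : ℋ) (A y)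

/-- A unitary propagator with time parameters in `I`. The values `U t s` with `t` or `s` outside `I`
play no role. -/
structure IsUnitaryPropagator {ℋ : Type*} [NormedAddCommGroup ℋ] [InnerProductSpace ℂ ℋ]
    (I : Set ℝ) (U : ℝ → ℝ → (ℋ ≃ₗᵢ[ℂ] ℋ)) : Prop where
  comp : ∀ r ∈ I, ∀ s ∈ I, ∀ t ∈ I, ∀ Ψ : ℋ, U r s (U s t Ψ) = U r t Ψ
  refl : ∀ t ∈ I, ∀ Ψ : ℋ, U t t Ψ = Ψ
  jointly_strongly_continuous :
    ∀ Ψ : ℋ, ContinuousOn (fun p : ℝ × ℝ => U p.1 p.2 Ψ) (I ×ˢ I)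

/-- `U` is strongly differentiable on `D`: for each `Ψ ∈ D` the map `(t, s) ↦ U t s Ψ` is
differentiable on `I × I` for the norm of the Hilbert space (one-sidedly at endpoints in `I`). -/
def IsStronglyDifferentiable {ℋ : Type*} [NormedAddCommGroup ℋ] [InnerProductSpace ℂ ℋ]
    (I : Set ℝ) (D : Submodule ℂ ℋ) (U : ℝ → ℝ → (ℋ ≃ₗᵢ[ℂ] ℋ)) : Prop :=
  ∀ Ψ ∈ D, DifferentiableOn ℝ (fun p : ℝ × ℝ => U p.1 p.2 Ψ) (I ×ˢ I)

/-- The curve `Ψ` solves `Ψ'(t) = -i A(t) Ψ(t)` on `I`: each `Ψ t` lies in the domain of `A t`, and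
the equation holds with the derivative taken in the norm (one-sided at endpoints in `I`). -/
def SolvesSchrodinger {ℋ : Type*} [NormedAddCommGroup ℋ] [InnerProductSpace ℂ ℋ]
    (I : Set ℝ) (A : ℝ → ℋ →ₗ.[ℂ] ℋ) (Ψ : ℝ → ℋ) : Prop :=
  ∀ t ∈ I, ∃ h : Ψ t ∈ (A t).domain,
    HasDerivWithinAt Ψ (-(Complex.I • (A t) ⟨Ψ t, h⟩)) I t

/-! The domain is constant and each `H i` is bounded relative to `H(t)` uniformly in `t`, so the
unbounded problem is governed by bounded operators: `R(t) = (H(t) + i)⁻¹` and `B(t) = H'(t) R(t)`.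
The second resolvent identity gives `R' = -R B` in operator norm, with `B` norm continuous
(`hasDerivWithinAt_resolventCLM`, `continuousOn_derivRelativeCLM`).

Replace `H(t)` by its Yosida approximation `Y`, which is bounded, symmetric and norm continuous; `u'
= -iYu` then has isometric solutions. The crucial point is a graph norm bound that does not depend
on the Yosida parameter. If `Φ' = (-iY + B)Φ` with `Φ(s) = (H(s) + i)y`, then `RΦ` solves the Yosida
equation, because `Y` commutes with `R`. Hence `u(t,s)y = R(t)Φ(t)` lies in `D`, and only `B`
contributes to the growth of `‖Φ‖` (`exists_mem_norm_sq_add_le`).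

On vectors with bounded graph norm, `Y` approximates `H` in the quadratic form sense with error
`O(1/λ)`, so the approximate evolutions form a Cauchy sequence (`norm_sub_sq_le`). The limit `U`
preserves `D` because `H(t)` is self-adjoint. Its derivative at `t = s` comes from weak convergence
of the difference quotients to `-iH(s)y`, together with an upper bound on their norms that tends to
`‖H(s)y‖` (`hasDerivWithinAt_diag`). The composition law carries this derivative to all times and to
both variables. -/

open Set Filter Topology Asymptotics

/-! ### Linear differential equations with bounded coefficients. -/

/-- Energy estimate: a curve whose norm has logarithmic derivative at most `c` in absolute value
grows at most exponentially, in both time directions. -/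
theorem norm_le_exp_mul_norm_of_abs_re_inner_le {E : Type*} [NormedAddCommGroup E]
    [InnerProductSpace ℂ E] {x x' : ℝ → E} {c s t : ℝ}
    (hx : ∀ r ∈ uIcc s t, HasDerivWithinAt x (x' r) (uIcc s t) r)
    (hc : ∀ r ∈ uIcc s t, |(inner ℂ (x r) (x' r)).re| ≤ c * ‖x r‖ ^ 2) :
    ‖x t‖ ≤ Real.exp (c * |t - s|) * ‖x s‖ := by
  have hg : ∀ r ∈ uIcc s t, HasDerivWithinAt (fun r => ‖x r‖ ^ 2)
      (2 * (inner ℂ (x r) (x' r)).re) (uIcc s t) r := by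
    intro r hr
    have h1 := (hx r hr).inner ℂ (hx r hr)
    have h2 := Complex.reCLM.hasFDerivAt.comp_hasDerivWithinAt r h1
    have h3 : (fun r => ‖x r‖ ^ 2) = Complex.reCLM ∘ fun r => inner ℂ (x r) (x r) := by
      ext r
      simp [← Complex.ofReal_pow]
    rw [h3]
    have h4 : 2 * (inner ℂ (x r) (x' r)).re =
        Complex.reCLM (inner ℂ (x r) (x' r) + inner ℂ (x' r) (x r)) := by
      have := inner_re_symm (𝕜 := ℂ) (x r) (x' r)
      simp only [RCLike.re_to_complex] at this
      rw [Complex.reCLM_apply, Complex.add_re, ← this]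
      ring
    rw [h4]
    exact h2
  have hsq : ‖x t‖ ^ 2 ≤ (Real.exp (c * |t - s|) * ‖x s‖) ^ 2 := by
    have hexp : ∀ k r : ℝ, HasDerivAt (fun r => Real.exp (k * (r - s)))
        (Real.exp (k * (r - s)) * k) r := by
      intro k r
      simpa using (((hasDerivAt_id r).sub_const s).const_mul k).exp
    -- The weight with `k = -2c` makes the product decreasing, which serves `s ≤ t`; with `k = 2c`
    -- it is increasing, which serves `t ≤ s`.
    have hd : ∀ k, ∀ r ∈ uIcc s t,
        HasDerivWithinAt (fun r => Real.exp (k * (r - s)) * ‖x r‖ ^ 2)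
        (Real.exp (k * (r - s)) * k * ‖x r‖ ^ 2 +
          Real.exp (k * (r - s)) * (2 * (inner ℂ (x r) (x' r)).re)) (uIcc s t) r :=
      fun k r hr => (hexp k r).hasDerivWithinAt.mul (hg r hr)
    have hcont : ∀ k, ContinuousOn (fun r => Real.exp (k * (r - s)) * ‖x r‖ ^ 2) (uIcc s t) :=
      fun k r hr => (hd k r hr).continuousWithinAt
    have hint : ∀ k, ∀ r ∈ interior (uIcc s t),
        HasDerivWithinAt (fun r => Real.exp (k * (r - s)) * ‖x r‖ ^ 2)
        (Real.exp (k * (r - s)) * k * ‖x r‖ ^ 2 +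
          Real.exp (k * (r - s)) * (2 * (inner ℂ (x r) (x' r)).re)) (interior (uIcc s t)) r :=
      fun k r hr => (hd k r (interior_subset hr)).mono interior_subset
    rcases le_total s t with hst | hst
    · have := antitoneOn_of_hasDerivWithinAt_nonpos (convex_uIcc s t) (hcont (-(2 * c)))
        (hint (-(2 * c))) (fun r hr => by
          have := abs_le.1 (hc r (interior_subset hr))
          have h0 := Real.exp_pos (-(2 * c) * (r - s))
          nlinarith)
      have h := this left_mem_uIcc right_mem_uIcc hst
      simp only [sub_self, mul_zero, Real.exp_zero, one_mul] at h
      rw [abs_of_nonneg (sub_nonneg.2 hst), mul_pow, ← Real.exp_nat_mul]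
      have h0 := Real.exp_pos (2 * (c * (t - s)))
      calc ‖x t‖ ^ 2 = Real.exp (2 * (c * (t - s))) *
            (Real.exp (-(2 * c) * (t - s)) * ‖x t‖ ^ 2) := by
            rw [← mul_assoc, ← Real.exp_add]
            ring_nf
            simp
        _ ≤ _ := by
            push_cast
            gcongr
    · have := monotoneOn_of_hasDerivWithinAt_nonneg (convex_uIcc s t) (hcont (2 * c))
        (hint (2 * c)) (fun r hr => by
          have := abs_le.1 (hc r (interior_subset hr))
          have h0 := Real.exp_pos (2 * c * (r - s))
          nlinarith)
      have h := this right_mem_uIcc left_mem_uIcc hst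
      simp only [sub_self, mul_zero, Real.exp_zero, one_mul] at h
      rw [abs_of_nonpos (sub_nonpos.2 hst), mul_pow, ← Real.exp_nat_mul]
      have h0 := Real.exp_pos (2 * (c * (t - s)))
      calc ‖x t‖ ^ 2 = Real.exp (2 * (c * -(t - s))) *
            (Real.exp (2 * c * (t - s)) * ‖x t‖ ^ 2) := by
            rw [← mul_assoc, ← Real.exp_add]
            ring_nf
            simp
        _ ≤ _ := by
            push_cast
            gcongr
  exact le_of_sq_le_sq hsq (by positivity)

/-- The difference of two solutions solves the same equation and vanishes at `s`; the energy
estimate, with `c` a bound for `‖A‖` on the segment, keeps it zero. -/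
theorem eqOn_of_linear_ode {E : Type*} [NormedAddCommGroup E] [InnerProductSpace ℂ E]
    {I : Set ℝ} (hI : I.OrdConnected) {A : ℝ → E →L[ℂ] E} (hA : ContinuousOn A I) {x y : ℝ → E}
    {s : ℝ} (hs : s ∈ I) (hx : ∀ t ∈ I, HasDerivWithinAt x (A t (x t)) I t)
    (hy : ∀ t ∈ I, HasDerivWithinAt y (A t (y t)) I t) (h : x s = y s) : EqOn x y I := by
  intro t ht
  have hsub := hI.uIcc_subset hs ht
  obtain ⟨C, hC⟩ := isCompact_uIcc.exists_bound_of_continuousOn (hA.mono hsub)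
  have := norm_le_exp_mul_norm_of_abs_re_inner_le (x := fun r => x r - y r)
    (x' := fun r => A r (x r - y r)) (c := C) (s := s) (t := t)
    (fun r hr => by
      rw [map_sub]
      exact ((hx r (hsub hr)).sub (hy r (hsub hr))).mono hsub)
    (fun r hr => by
      calc _ ≤ ‖inner ℂ (x r - y r) (A r (x r - y r))‖ := Complex.abs_re_le_norm _
        _ ≤ ‖x r - y r‖ * ‖A r (x r - y r)‖ := norm_inner_le_norm _ _
        _ ≤ ‖x r - y r‖ * (C * ‖x r - y r‖) := by
          gcongr
          exact (A r).le_of_opNorm_le (hC r hr) _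
        _ = _ := by ring)
  simp only [h, sub_self, norm_zero, mul_zero, norm_le_zero_iff] at this
  exact sub_eq_zero.1 this

/-- Linear ODEs with bounded coefficients are globally solvable on compact intervals. -/
theorem exists_linear_ode_solution_Icc {E : Type*} [NormedAddCommGroup E] [InnerProductSpace ℂ E]
    [CompleteSpace E] {a b s : ℝ} (hs : s ∈ Icc a b) {A : ℝ → E →L[ℂ] E}
    (hA : ContinuousOn A (Icc a b)) (x₀ : E) :
    ∃ x : ℝ → E, x s = x₀ ∧ ∀ t ∈ Icc a b, HasDerivWithinAt x (A t (x t)) (Icc a b) t := by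
  obtain ⟨C, hC⟩ := isCompact_Icc.exists_bound_of_continuousOn hA
  have hC0 : 0 ≤ C := (norm_nonneg _).trans (hC s hs)
  -- `M` is the a priori bound that the energy estimate imposes on any solution.
  obtain ⟨M, hM0, hM⟩ : ∃ M : ℝ, 0 < M ∧ Real.exp (C * (b - a)) * ‖x₀‖ ≤ M :=
    ⟨Real.exp (C * (b - a)) * ‖x₀‖ + 1, by positivity, by linarith⟩
  -- A Lipschitz cutoff, equal to 1 for `‖x‖ ≤ M` and to 0 for `‖x‖ ≥ 2M`. The truncated field is
  -- bounded by `2CM`, so a Picard–Lindelöf ball of radius `2CM(b - a)` covers all of `[a, b]` at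
  -- once.
  let θ : E → ℝ := fun x => max 0 (min 1 (2 - ‖x‖ / M))
  have θ0 : ∀ x, 0 ≤ θ x := fun x => le_max_left _ _
  have θ1 : ∀ x, θ x ≤ 1 := fun x => max_le zero_le_one (min_le_left _ _)
  have θM : ∀ x, θ x * ‖x‖ ≤ 2 * M := by
    intro x
    rcases le_or_gt ‖x‖ (2 * M) with h | h
    · calc _ ≤ 1 * ‖x‖ := by gcongr; exact θ1 x
        _ ≤ _ := by linarith
    · have : θ x = 0 := by
        apply max_eq_left
        apply (min_le_right _ _).trans
        rw [sub_nonpos, le_div_iff₀ hM0]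
        exact h.le
      rw [this]
      linarith
  have θL : ∀ x y, |θ x - θ y| ≤ ‖x - y‖ / M := by
    intro x y
    calc |θ x - θ y| ≤ |min 1 (2 - ‖x‖ / M) - min 1 (2 - ‖y‖ / M)| := by
          simpa using abs_max_sub_max_le_max 0 (min 1 (2 - ‖x‖ / M)) 0 (min 1 (2 - ‖y‖ / M))
      _ ≤ |(2 - ‖x‖ / M) - (2 - ‖y‖ / M)| := by
          simpa using abs_min_sub_min_le_max 1 (2 - ‖x‖ / M) 1 (2 - ‖y‖ / M)
      _ = |‖y‖ - ‖x‖| / M := by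
          rw [← abs_of_pos hM0, ← abs_div, abs_of_pos hM0]
          ring_nf
      _ ≤ ‖x - y‖ / M := by
          gcongr
          rw [norm_sub_rev]
          exact abs_norm_sub_norm_le y x
  have θx : ∀ x, ‖x‖ ≤ M → θ x = 1 := by
    intro x hx
    have : ‖x‖ / M ≤ 1 := (div_le_one hM0).2 hx
    simp only [θ]
    rw [min_eq_left (by linarith), max_eq_right zero_le_one]
  let F : ℝ → E → E := fun t x => A t ((θ x : ℂ) • x)
  let L : NNReal := ⟨C * (2 * M), by positivity⟩
  let r : NNReal := ⟨C * (2 * M) * (b - a), by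
    have := hs.1.trans hs.2
    have := sub_nonneg.2 this
    positivity⟩
  let K : NNReal := ⟨C * (1 + (‖x₀‖ + r) / M), by positivity⟩
  have hP : IsPicardLindelof F (⟨s, hs⟩ : Icc a b) x₀ r 0 L K := by
    refine ⟨?_, ?_, ?_, ?_⟩
    · intro t ht
      apply LipschitzOnWith.of_dist_le_mul
      intro x hx y hy
      rw [dist_eq_norm, dist_eq_norm, ← map_sub]
      have hyn : ‖y‖ ≤ ‖x₀‖ + r := by
        rw [mem_closedBall_iff_norm] at hy
        calc ‖y‖ = ‖x₀ + (y - x₀)‖ := by simp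
          _ ≤ _ := (norm_add_le _ _).trans (by gcongr)
      have h1 : (θ x : ℂ) • x - (θ y : ℂ) • y
          = (θ x : ℂ) • (x - y) + ((θ x - θ y : ℝ) : ℂ) • y := by
        push_cast
        module
      calc _ ≤ C * ‖(θ x : ℂ) • x - (θ y : ℂ) • y‖ := (A t).le_of_opNorm_le (hC t ht) _
        _ ≤ C * (1 * ‖x - y‖ + ‖x - y‖ / M * (‖x₀‖ + r)) := by
          rw [h1]
          gcongr
          refine (norm_add_le _ _).trans ?_
          rw [norm_smul, norm_smul, Complex.norm_real, Complex.norm_real, Real.norm_eq_abs,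
            Real.norm_eq_abs, abs_of_nonneg (θ0 x)]
          gcongr
          · exact θ1 x
          · exact θL x y
        _ = C * (1 + (‖x₀‖ + r) / M) * ‖x - y‖ := by ring
        _ = _ := rfl
    · intro x _
      exact hA.clm_apply continuousOn_const
    · intro t ht x _
      calc _ ≤ C * ‖(θ x : ℂ) • x‖ := (A t).le_of_opNorm_le (hC t ht) _
        _ ≤ C * (2 * M) := by
          gcongr
          rw [norm_smul, Complex.norm_real, Real.norm_eq_abs, abs_of_nonneg (θ0 x)]
          exact θM x
        _ = _ := rfl
    · have : max (b - s) (s - a) ≤ b - a := max_le (by linarith [hs.1]) (by linarith [hs.2])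
      simp only [NNReal.coe_zero, sub_zero]
      change C * (2 * M) * max (b - s) (s - a) ≤ C * (2 * M) * (b - a)
      gcongr
  obtain ⟨x, hxs, hx⟩ := hP.exists_eq_forall_mem_Icc_hasDerivWithinAt₀
  refine ⟨x, hxs, fun t ht => ?_⟩
  have hsub : uIcc s t ⊆ Icc a b := ordConnected_Icc.uIcc_subset hs ht
  have hb := norm_le_exp_mul_norm_of_abs_re_inner_le (x := x)
    (x' := fun r => F r (x r)) (c := C) (s := s) (t := t)
    (fun r hr => (hx r (hsub hr)).mono hsub)
    (fun r hr => by
      calc _ ≤ ‖inner ℂ (x r) (F r (x r))‖ := Complex.abs_re_le_norm _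
        _ ≤ ‖x r‖ * ‖F r (x r)‖ := norm_inner_le_norm _ _
        _ ≤ ‖x r‖ * (C * (1 * ‖x r‖)) := by
          gcongr
          refine ((A r).le_of_opNorm_le (hC r (hsub hr)) _).trans ?_
          gcongr
          rw [norm_smul, Complex.norm_real, Real.norm_eq_abs, abs_of_nonneg (θ0 _)]
          gcongr
          exact θ1 _
        _ = _ := by ring)
  -- The cutoff does not spoil the energy estimate since `θ ≤ 1`; hence the solution stays where `θ
  -- = 1` and solves the original equation.
  have hle : ‖x t‖ ≤ M := by
    refine hb.trans (le_trans ?_ hM)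
    rw [show x s = x₀ from hxs]
    gcongr
    rw [abs_le]
    constructor <;> linarith [hs.1, hs.2, ht.1, ht.2]
  have := hx t ht
  simpa only [F, θx _ hle, Complex.ofReal_one, one_smul] using this

/-- Lets a derivative within a compact interval be read as a derivative within `I`. At an endpoint
of `I`, the point `t` itself bounds the interval on that side. -/
theorem Set.OrdConnected.exists_Icc_mem_nhdsWithin {I : Set ℝ} {s t : ℝ}
    (hs : s ∈ I) (ht : t ∈ I) :
    ∃ a ∈ I, ∃ b ∈ I, s ∈ Icc a b ∧ t ∈ Icc a b ∧ Icc a b ∈ 𝓝[I] t := by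
  obtain ⟨a, haI, has, hat, ha⟩ : ∃ a ∈ I, a ≤ s ∧ a ≤ t ∧ Ici a ∈ 𝓝[I] t := by
    by_cases h : ∃ a ∈ I, a < t
    · obtain ⟨a, haI, ha⟩ := h
      rcases le_total a s with h | h
      · exact ⟨a, haI, h, ha.le, mem_nhdsWithin_of_mem_nhds (Ici_mem_nhds ha)⟩
      · exact ⟨s, hs, le_rfl, h.trans ha.le,
          mem_nhdsWithin_of_mem_nhds (Ici_mem_nhds (h.trans_lt ha))⟩
    · push Not at h
      exact ⟨t, ht, h s hs, le_rfl, mem_of_superset self_mem_nhdsWithin h⟩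
  obtain ⟨b, hbI, hbs, hbt, hb⟩ : ∃ b ∈ I, s ≤ b ∧ t ≤ b ∧ Iic b ∈ 𝓝[I] t := by
    by_cases h : ∃ a ∈ I, t < a
    · obtain ⟨a, haI, ha⟩ := h
      rcases le_total s a with h | h
      · exact ⟨a, haI, h, ha.le, mem_nhdsWithin_of_mem_nhds (Iic_mem_nhds ha)⟩
      · exact ⟨s, hs, le_rfl, ha.le.trans h,
          mem_nhdsWithin_of_mem_nhds (Iic_mem_nhds (ha.trans_le h))⟩
    · push Not at h
      exact ⟨t, ht, h s hs, le_rfl, mem_of_superset self_mem_nhdsWithin h⟩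
  exact ⟨a, haI, b, hbI, ⟨has, hbs⟩, ⟨hat, hbt⟩, inter_mem ha hb⟩

/-- Linear ODEs with bounded, norm continuous coefficients are globally solvable on intervals. -/
theorem exists_linear_ode_solution {E : Type*} [NormedAddCommGroup E] [InnerProductSpace ℂ E]
    [CompleteSpace E] {I : Set ℝ} (hI : I.OrdConnected) {A : ℝ → E →L[ℂ] E}
    (hA : ContinuousOn A I) {s : ℝ} (hs : s ∈ I) (x₀ : E) :
    ∃ x : ℝ → E, x s = x₀ ∧ ∀ t ∈ I, HasDerivWithinAt x (A t (x t)) I t := by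
  have hex : ∀ t ∈ I, ∃ x : ℝ → E, x s = x₀ ∧
      ∀ r ∈ uIcc s t, HasDerivWithinAt x (A r (x r)) (uIcc s t) r :=
    fun t ht => exists_linear_ode_solution_Icc left_mem_uIcc (hA.mono (hI.uIcc_subset hs ht)) x₀
  choose! y hys hy using hex
  -- The value at `t` is taken from the solution on the segment from `s` to `t`; by uniqueness this
  -- diagonal agrees near `t` with a single solution.
  refine ⟨fun t => y t t, hys s hs, fun t ht => ?_⟩
  obtain ⟨a, ha, b, hb, hsab, htab, hnhds⟩ := Set.OrdConnected.exists_Icc_mem_nhdsWithin hs ht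
  have hab := hI.out ha hb
  obtain ⟨x, hxs, hx⟩ := exists_linear_ode_solution_Icc hsab (hA.mono hab) x₀
  have heq : ∀ r ∈ Icc a b, y r r = x r := by
    intro r hr
    have hsub : uIcc s r ⊆ Icc a b := ordConnected_Icc.uIcc_subset hsab hr
    exact eqOn_of_linear_ode ordConnected_uIcc (hA.mono (hsub.trans hab)) left_mem_uIcc
      (hy r (hab hr)) (fun q hq => (hx q (hsub hq)).mono hsub) ((hys r (hab hr)).trans hxs.symm)
      right_mem_uIcc
  have h1 : HasDerivWithinAt x (A t (y t t)) I t := by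
    rw [heq t htab]
    exact (hx t htab).mono_of_mem_nhdsWithin hnhds
  exact h1.congr_of_eventuallyEq (eventually_of_mem hnhds heq) (heq t htab)

/-! ### Self-adjoint operators and their resolvents at imaginary points. -/

/-- Concrete form of self-adjointness for an everywhere defined map `T` on a dense subspace `D`. -/
structure IsSelfAdjointOn {ℋ : Type*} [NormedAddCommGroup ℋ] [InnerProductSpace ℂ ℋ]
    (D : Submodule ℂ ℋ) (T : D →ₗ[ℂ] ℋ) : Prop where
  dense : Dense (D : Set ℋ)
  symm : ∀ x y : D, inner ℂ (T x) (y : ℋ) = inner ℂ (x : ℋ) (T y)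
  mem : ∀ x w : ℋ, (∀ y : D, inner ℂ w (y : ℋ) = inner ℂ x (T y)) → ∃ h : x ∈ D, T ⟨x, h⟩ = w
  mem_of_bound : ∀ (x : ℋ) (C : ℝ), (∀ y : D, ‖inner ℂ x (T y)‖ ≤ C * ‖(y : ℋ)‖) → x ∈ D

/-- `mem` and `mem_of_bound` are two descriptions of the domain of the adjoint. The first yields
closedness of the range and the vanishing of its orthogonal complement, the second keeps limits of
evolutions in `D`. -/
theorem IsSelfAdjoint.isSelfAdjointOn {ℋ : Type*} [NormedAddCommGroup ℋ] [InnerProductSpace ℂ ℋ]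
    [CompleteSpace ℋ] {A : ℋ →ₗ.[ℂ] ℋ} (hA : IsSelfAdjoint A) :
    IsSelfAdjointOn A.domain A.toFun := by
  have hd := hA.dense_domain
  have hadj : A.adjoint = A := hA
  have hmem : ∀ x w : ℋ, (∀ y : A.domain, inner ℂ w (y : ℋ) = inner ℂ x (A y)) →
      ∃ h : x ∈ A.domain, A ⟨x, h⟩ = w := by
    intro x w h
    have hx : x ∈ A.adjoint.domain := A.mem_adjoint_domain_of_exists x ⟨w, h⟩
    have h2 : A.adjoint ⟨x, hx⟩ = w := A.adjoint_apply_eq hd ⟨x, hx⟩ h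
    have hgr : (x, w) ∈ A.adjoint.graph := by
      rw [← h2]
      exact A.adjoint.mem_graph ⟨x, hx⟩
    rw [hadj, LinearPMap.mem_graph_iff] at hgr
    obtain ⟨y, hy, hy'⟩ := hgr
    simp only at hy hy'
    subst hy
    exact ⟨y.2, hy'⟩
  refine ⟨hd, ?_, hmem, ?_⟩
  · intro x y
    have := A.adjoint_isFormalAdjoint hd
    rw [hadj] at this
    exact this x y
  · intro x C hC
    have : x ∈ A.adjoint.domain := by
      rw [LinearPMap.mem_adjoint_domain_iff]
      exact AddMonoidHomClass.continuous_of_bound ((innerₛₗ ℂ x).comp A.toFun) C hC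
    rwa [hadj] at this

/-- The resolvent `(T + iλ)⁻¹` with values in the domain (zero if `T + iλ` is not bijective). -/
noncomputable def imagResolvent {ℋ : Type*} [NormedAddCommGroup ℋ] [InnerProductSpace ℂ ℋ]
    {D : Submodule ℂ ℋ} (T : D →ₗ[ℂ] ℋ) (l : ℝ) : ℋ →ₗ[ℂ] D :=
  open Classical in
  if h : Function.Bijective (T + ((l : ℂ) * Complex.I) • D.subtype) then
    (LinearEquiv.ofBijective _ h).symm else 0

/-- A linear map as a continuous linear map (zero if it is not bounded). -/
noncomputable def LinearMap.toBounded {E F : Type*} [NormedAddCommGroup E]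
    [NormedSpace ℂ E] [NormedAddCommGroup F] [NormedSpace ℂ F] (L : E →ₗ[ℂ] F) : E →L[ℂ] F :=
  open Classical in
  if h : ∃ C, ∀ x, ‖L x‖ ≤ C * ‖x‖ then L.mkContinuousOfExistsBound h else 0

theorem LinearMap.toBounded_apply {E F : Type*} [NormedAddCommGroup E]
    [NormedSpace ℂ E] [NormedAddCommGroup F] [NormedSpace ℂ F] {L : E →ₗ[ℂ] F} {C : ℝ}
    (h : ∀ x, ‖L x‖ ≤ C * ‖x‖) (x : E) : L.toBounded x = L x := by
  have h' : ∃ C, ∀ x, ‖L x‖ ≤ C * ‖x‖ := ⟨C, h⟩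
  simp [LinearMap.toBounded, h']

namespace IsSelfAdjointOn

variable {ℋ : Type*} [NormedAddCommGroup ℋ] [InnerProductSpace ℂ ℋ] {D : Submodule ℂ ℋ}
  {T : D →ₗ[ℂ] ℋ}

theorem im_inner_eq_zero (hT : IsSelfAdjointOn D T) (x : D) :
    (inner ℂ (x : ℋ) (T x)).im = 0 := by
  have h1 := hT.symm x x
  rw [← inner_conj_symm] at h1
  exact Complex.conj_eq_iff_im.1 h1

/-- The cross term vanishes because `⟪T x, x⟫` is real. Both resolvent bounds and the graph norm
identity follow from this. -/
theorem norm_sq_add (hT : IsSelfAdjointOn D T) (l : ℝ) (x : D) :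
    ‖T x + ((l : ℂ) * Complex.I) • (x : ℋ)‖ ^ 2 = ‖T x‖ ^ 2 + l ^ 2 * ‖(x : ℋ)‖ ^ 2 := by
  have h0 := hT.im_inner_eq_zero x
  have h1 : (inner ℂ (T x) (x : ℋ)).im = 0 := by rw [hT.symm]; exact h0
  have := norm_add_sq (𝕜 := ℂ) (T x) (((l : ℂ) * Complex.I) • (x : ℋ))
  rw [this, inner_smul_right, norm_smul]
  simp [h1, mul_pow]

theorem norm_le_norm_add (hT : IsSelfAdjointOn D T) (l : ℝ) (x : D) :
    ‖T x‖ ≤ ‖T x + ((l : ℂ) * Complex.I) • (x : ℋ)‖ := by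
  have := hT.norm_sq_add l x
  apply le_of_sq_le_sq _ (norm_nonneg _)
  rw [this]
  have : 0 ≤ l ^ 2 * ‖(x : ℋ)‖ ^ 2 := by positivity
  linarith

theorem abs_mul_norm_le_norm_add (hT : IsSelfAdjointOn D T) (l : ℝ) (x : D) :
    |l| * ‖(x : ℋ)‖ ≤ ‖T x + ((l : ℂ) * Complex.I) • (x : ℋ)‖ := by
  have := hT.norm_sq_add l x
  apply le_of_sq_le_sq _ (norm_nonneg _)
  rw [this, mul_pow, sq_abs]
  have : 0 ≤ ‖T x‖ ^ 2 := by positivity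
  linarith

/-- The basic criterion: `T + iλ` is bounded below, hence injective with closed range. A vector `z`
orthogonal to the range satisfies `T z = iλ z`, which contradicts the reality of `⟪z, T z⟫` unless
`z = 0`. -/
theorem bijective_add [CompleteSpace ℋ] (hT : IsSelfAdjointOn D T) {l : ℝ} (hl : l ≠ 0) :
    Function.Bijective (T + ((l : ℂ) * Complex.I) • D.subtype) := by
  have hl' : 0 < |l| := abs_pos.2 hl
  set S := T + ((l : ℂ) * Complex.I) • D.subtype with hS
  have hSx : ∀ x, S x = T x + ((l : ℂ) * Complex.I) • (x : ℋ) := fun x => rfl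
  have hbd : ∀ x : D, |l| * ‖(x : ℋ)‖ ≤ ‖S x‖ := fun x => hT.abs_mul_norm_le_norm_add l x
  have hinj : Function.Injective S := by
    rw [injective_iff_map_eq_zero]
    intro x hx
    have := hbd x
    rw [hx, norm_zero] at this
    have h0 : ‖(x : ℋ)‖ ≤ 0 := by
      by_contra h
      push Not at h
      have := mul_pos hl' h
      linarith
    exact Subtype.ext (norm_le_zero_iff.1 h0)
  refine ⟨hinj, ?_⟩
  have hclosed : IsClosed (LinearMap.range S : Set ℋ) := by
    apply isClosed_of_closure_subset
    intro z hz
    obtain ⟨w, hw, hwz⟩ := mem_closure_iff_seq_limit.1 hz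
    choose x hx using hw
    have hcw := hwz.cauchySeq
    have hcx : CauchySeq fun k => (x k : ℋ) := by
      rw [Metric.cauchySeq_iff'] at hcw ⊢
      intro ε hε
      obtain ⟨N, hN⟩ := hcw (|l| * ε) (by positivity)
      refine ⟨N, fun k hk => ?_⟩
      have h1 := hN k hk
      have h2 := hbd (x k - x N)
      rw [map_sub, hx, hx] at h2
      rw [dist_eq_norm] at h1 ⊢
      rw [← Submodule.coe_sub]
      exact lt_of_mul_lt_mul_left (h2.trans_lt h1) hl'.le
    obtain ⟨y, hy⟩ := cauchySeq_tendsto_of_complete hcx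
    have hTx : Tendsto (fun k => T (x k)) atTop (𝓝 (z - ((l : ℂ) * Complex.I) • y)) := by
      have : (fun k => T (x k)) = fun k => w k - ((l : ℂ) * Complex.I) • (x k : ℋ) := by
        ext k
        rw [← hx, hSx]
        abel
      rw [this]
      exact hwz.sub (hy.const_smul _)
    obtain ⟨hyD, hTy⟩ := hT.mem y (z - ((l : ℂ) * Complex.I) • y) (fun v => by
      have h1 : Tendsto (fun k => inner ℂ (T (x k)) (v : ℋ)) atTop
          (𝓝 (inner ℂ (z - ((l : ℂ) * Complex.I) • y) (v : ℋ))) :=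
        hTx.inner tendsto_const_nhds
      have h2 : Tendsto (fun k => inner ℂ (x k : ℋ) (T v)) atTop (𝓝 (inner ℂ y (T v))) :=
        hy.inner tendsto_const_nhds
      simp only [hT.symm] at h1
      exact tendsto_nhds_unique h1 h2)
    refine ⟨⟨y, hyD⟩, ?_⟩
    rw [hSx, hTy]
    simp
  have : CompleteSpace (LinearMap.range S) := hclosed.completeSpace_coe
  rw [← LinearMap.range_eq_top, ← Submodule.orthogonal_eq_bot_iff, Submodule.eq_bot_iff]
  intro z hz
  have hz' : ∀ y : D, inner ℂ (((l : ℂ) * Complex.I) • z) (y : ℋ) = inner ℂ z (T y) := by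
    intro y
    have h1 := (Submodule.mem_orthogonal' _ _).1 hz (S y) ⟨y, rfl⟩
    rw [hSx, inner_add_right, inner_smul_right] at h1
    rw [inner_smul_left]
    simp only [map_mul, Complex.conj_ofReal, Complex.conj_I]
    linear_combination -h1
  obtain ⟨hzD, hTz⟩ := hT.mem z _ hz'
  have h0 : S (-⟨z, hzD⟩) = S ⟨z, hzD⟩ - (2 : ℂ) • S ⟨z, hzD⟩ := by
    rw [map_neg]
    module
  have h1 := hT.im_inner_eq_zero ⟨z, hzD⟩
  rw [hTz] at h1
  simp only [inner_smul_right, inner_self_eq_norm_sq_to_K] at h1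
  simp [← Complex.ofReal_pow, hl] at h1
  exact h1

section Resolvent

variable [CompleteSpace ℋ] (hT : IsSelfAdjointOn D T) {l : ℝ} (hl : l ≠ 0)
include hT hl

theorem apply_imagResolvent (z : ℋ) :
    T (imagResolvent T l z) + ((l : ℂ) * Complex.I) • (imagResolvent T l z : ℋ) = z := by
  have h := hT.bijective_add hl
  have := (LinearEquiv.ofBijective _ h).apply_symm_apply z
  rw [imagResolvent, dif_pos h]
  exact this

theorem imagResolvent_apply_add (y : D) :
    imagResolvent T l (T y + ((l : ℂ) * Complex.I) • (y : ℋ)) = y := by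
  have h := hT.bijective_add hl
  have := (LinearEquiv.ofBijective _ h).symm_apply_apply y
  simpa [imagResolvent, h] using this

theorem imagResolvent_apply (y : D) :
    imagResolvent T l (T y) = y - ((l : ℂ) * Complex.I) • imagResolvent T l (y : ℋ) := by
  have := hT.imagResolvent_apply_add hl y
  rw [map_add, map_smul] at this
  exact eq_sub_of_add_eq this

theorem norm_apply_imagResolvent_le (z : ℋ) : ‖T (imagResolvent T l z)‖ ≤ ‖z‖ := by
  have := hT.norm_le_norm_add l (imagResolvent T l z)
  rwa [hT.apply_imagResolvent hl] at this

theorem norm_imagResolvent_le (z : ℋ) : ‖(imagResolvent T l z : ℋ)‖ ≤ |l|⁻¹ * ‖z‖ := by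
  have := hT.abs_mul_norm_le_norm_add l (imagResolvent T l z)
  rw [hT.apply_imagResolvent hl] at this
  rwa [le_inv_mul_iff₀ (abs_pos.2 hl)]

theorem inner_imagResolvent (x y : ℋ) :
    inner ℂ (imagResolvent T l x : ℋ) y = inner ℂ x (imagResolvent T (-l) y : ℋ) := by
  have h1 := hT.apply_imagResolvent hl x
  have h2 := hT.apply_imagResolvent (neg_ne_zero.2 hl) y
  have h3 := hT.symm (imagResolvent T l x) (imagResolvent T (-l) y)
  calc inner ℂ (imagResolvent T l x : ℋ) y
      = inner ℂ (imagResolvent T l x : ℋ) (T (imagResolvent T (-l) y) +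
        (((-l : ℝ) : ℂ) * Complex.I) • (imagResolvent T (-l) y : ℋ)) := by rw [h2]
    _ = inner ℂ (T (imagResolvent T l x) + ((l : ℂ) * Complex.I) • (imagResolvent T l x : ℋ))
        (imagResolvent T (-l) y : ℋ) := by
      rw [inner_add_right, inner_add_left, h3, inner_smul_left, inner_smul_right]
      simp
    _ = inner ℂ x (imagResolvent T (-l) y : ℋ) := by rw [h1]

/-- Computing `R_l T R_m z` in two ways gives the first resolvent identity; its right side is the
same for both orders of the product, and `l ≠ m` allows division. -/
theorem imagResolvent_comm {m : ℝ} (hm : m ≠ 0) (z : ℋ) :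
    imagResolvent T l (imagResolvent T m z : ℋ) = imagResolvent T m (imagResolvent T l z : ℋ) := by
  rcases eq_or_ne l m with rfl | hlm
  · rfl
  have h1 := hT.imagResolvent_apply hl (imagResolvent T m z)
  have h2 := hT.imagResolvent_apply hm (imagResolvent T l z)
  have e1 := hT.apply_imagResolvent hm z
  have e2 := hT.apply_imagResolvent hl z
  rw [← eq_sub_iff_add_eq] at e1 e2
  rw [e1, map_sub, map_smul] at h1
  rw [e2, map_sub, map_smul] at h2
  have h3 : (((l : ℂ) - m) * Complex.I) • (imagResolvent T l (imagResolvent T m z : ℋ) -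
      imagResolvent T m (imagResolvent T l z : ℋ)) = 0 := by
    have : ∀ (a b p q : D) (u v : ℂ), a - v • p = b - u • p → b - u • q = a - v • q →
      (u - v) • (p - q) = 0 := by
      intro a b p q u v h h'
      calc (u - v) • (p - q) = (a - v • p) - (b - u • p) + ((b - u • q) - (a - v • q)) := by module
        _ = 0 := by rw [h, h']; simp
    rw [sub_mul]
    exact this _ _ _ _ _ _ h1 h2
  have h4 : (((l : ℂ) - m) * Complex.I) ≠ 0 :=
    mul_ne_zero (sub_ne_zero.2 (by exact_mod_cast hlm)) Complex.I_ne_zero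
  exact sub_eq_zero.1 ((smul_eq_zero.1 h3).resolve_left h4)

end Resolvent

end IsSelfAdjointOn

/-! ### Families with constant domain: resolvents and Yosida approximations. -/

/-- The operator `H(t)` as a linear map defined on `D`. -/
noncomputable abbrev hamiltonianMap {ℋ : Type*} [NormedAddCommGroup ℋ]
    [InnerProductSpace ℂ ℋ] {n : ℕ} {D : Submodule ℂ ℋ} (H : Fin n → D →ₗ[ℂ] ℋ)
    (f : Fin n → ℝ → ℝ) (t : ℝ) : D →ₗ[ℂ] ℋ :=
  ∑ i, ((f i t : ℝ) : ℂ) • H i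

/-- Self-adjoint linear combinations `∑ i, f i t • H i` with uniform relative bounds and
continuously differentiable coefficients. -/
structure IsKatoFamily {ℋ : Type*} [NormedAddCommGroup ℋ] [InnerProductSpace ℂ ℋ] {n : ℕ}
    {D : Submodule ℂ ℋ} (H : Fin n → D →ₗ[ℂ] ℋ) (f : Fin n → ℝ → ℝ) (I : Set ℝ) : Prop where
  ordConnected : I.OrdConnected
  selfAdjoint : ∀ t ∈ I, IsSelfAdjointOn D (hamiltonianMap H f t)
  hasDeriv : ∀ i, ∀ t ∈ I, HasDerivWithinAt (f i) (derivWithin (f i) I t) I t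
  continuous_deriv : ∀ i, ContinuousOn (derivWithin (f i) I) I
  bound : ∀ i, ∃ K : ℝ, 0 < K ∧ ∀ t ∈ I, ∀ y : D,
    ‖H i y‖ ≤ K * (‖hamiltonianMap H f t y‖ + ‖(y : ℋ)‖)

section

variable {ℋ : Type*} [NormedAddCommGroup ℋ] [InnerProductSpace ℂ ℋ]

theorem HasDerivWithinAt.complex_clm_apply {A : ℝ → ℋ →L[ℂ] ℋ} {A' : ℋ →L[ℂ] ℋ} {x : ℝ → ℋ}
    {x' : ℋ} {I : Set ℝ} {t : ℝ} (hA : HasDerivWithinAt A A' I t)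
    (hx : HasDerivWithinAt x x' I t) :
    HasDerivWithinAt (fun t => A t (x t)) (A' (x t) + A t x') I t :=
  ((ContinuousLinearMap.restrictScalarsL ℂ ℋ ℋ ℝ ℝ).hasFDerivAt.comp_hasDerivWithinAt t
    hA).clm_apply hx

variable {n : ℕ} {f : Fin n → ℝ → ℝ} {I : Set ℝ} {X : ℝ → ℋ →L[ℂ] ℋ}
  {M : Fin n → ℝ → ℋ →L[ℂ] ℋ}

/-- Abstracts the second resolvent identity, which holds both for `X = R` and for `X = H i R`, with
`M j = H j R`. Uniform bounds alone then give norm continuity. -/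
theorem continuousOn_of_sub_eq_neg_sum {C : ℝ} {K : Fin n → ℝ}
    (hX : ∀ t ∈ I, ‖X t‖ ≤ C) (hM : ∀ j, ∀ t ∈ I, ‖M j t‖ ≤ K j)
    (hf : ∀ j, ContinuousOn (f j) I)
    (hid : ∀ t ∈ I, ∀ r ∈ I, X r - X t =
      -∑ j, ((f j r - f j t : ℝ) : ℂ) • (X r ∘L M j t)) : ContinuousOn X I := by
  intro t ht
  rw [ContinuousWithinAt, tendsto_iff_norm_sub_tendsto_zero]
  have hlim : Tendsto (fun r => ∑ j, |f j r - f j t| * (C * K j)) (𝓝[I] t) (𝓝 0) := by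
    have : (0 : ℝ) = ∑ j, |f j t - f j t| * (C * K j) := by simp
    rw [this]
    exact tendsto_finsetSum _ fun j _ =>
      (((hf j t ht).tendsto.sub_const _).abs.mul_const _)
  refine squeeze_zero' (Eventually.of_forall fun _ => norm_nonneg _) ?_ hlim
  filter_upwards [self_mem_nhdsWithin] with r hr
  rw [hid t ht r hr, norm_neg]
  refine (norm_sum_le _ _).trans (Finset.sum_le_sum fun j _ => ?_)
  rw [norm_smul, Complex.norm_real, Real.norm_eq_abs]
  gcongr
  exact ((X r).opNorm_comp_le _).trans (mul_le_mul (hX r hr) (hM j t ht) (norm_nonneg _)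
    ((norm_nonneg _).trans (hX r hr)))

/-- In the slope at `t` only `X r` and the scalar slopes vary, while `M j t` is fixed; continuity of
`X` therefore suffices. -/
theorem hasDerivWithinAt_of_sub_eq_neg_sum (hX : ContinuousOn X I) {f' : Fin n → ℝ} {t : ℝ}
    (ht : t ∈ I) (hf : ∀ j, HasDerivWithinAt (f j) (f' j) I t)
    (hid : ∀ r ∈ I, X r - X t = -∑ j, ((f j r - f j t : ℝ) : ℂ) • (X r ∘L M j t)) :
    HasDerivWithinAt X (-∑ j, ((f' j : ℝ) : ℂ) • (X t ∘L M j t)) I t := by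
  rw [hasDerivWithinAt_iff_tendsto_slope]
  have hlim : Tendsto (fun r => -∑ j, ((slope (f j) t r : ℝ) : ℂ) • (X r ∘L M j t)) (𝓝[I \ {t}] t)
      (𝓝 (-∑ j, ((f' j : ℝ) : ℂ) • (X t ∘L M j t))) := by
    refine (tendsto_finsetSum _ fun j _ => Tendsto.smul ?_ ?_).neg
    · exact (Complex.continuous_ofReal.tendsto _).comp
        (hasDerivWithinAt_iff_tendsto_slope.1 (hf j))
    · have h1 : Tendsto X (𝓝[I \ {t}] t) (𝓝 (X t)) :=
        (hX t ht).mono_left (nhdsWithin_mono _ sdiff_subset)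
      exact ((ContinuousLinearMap.compL ℂ ℋ ℋ ℋ).flip (M j t)).continuous.continuousAt.tendsto.comp
        h1
  refine hlim.congr' ?_
  filter_upwards [self_mem_nhdsWithin] with r hr
  rw [slope_def_module, hid r hr.1, smul_neg, Finset.smul_sum]
  congr 1
  refine Finset.sum_congr rfl fun j _ => ?_
  rw [slope_def_module, smul_eq_mul, Complex.ofReal_mul, mul_smul]
  rw [Complex.coe_smul]

end

section

variable {ℋ : Type*} [NormedAddCommGroup ℋ] [InnerProductSpace ℂ ℋ] {n : ℕ}
  {D : Submodule ℂ ℋ} (H : Fin n → D →ₗ[ℂ] ℋ) (f : Fin n → ℝ → ℝ)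

/-- The bounded operator `(H(t) + iλ)⁻¹`. -/
noncomputable def resolventCLM (l t : ℝ) : ℋ →L[ℂ] ℋ :=
  (D.subtype ∘ₗ imagResolvent (hamiltonianMap H f t) l).toBounded

/-- The bounded operator `H i (H(t) + iλ)⁻¹`. -/
noncomputable def relativeCLM (i : Fin n) (l t : ℝ) : ℋ →L[ℂ] ℋ :=
  (H i ∘ₗ imagResolvent (hamiltonianMap H f t) l).toBounded

/-- The bounded operator `H'(t) (H(t) + i)⁻¹`. -/
noncomputable def derivRelativeCLM (I : Set ℝ) (t : ℝ) : ℋ →L[ℂ] ℋ :=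
  ∑ i, ((derivWithin (f i) I t : ℝ) : ℂ) • relativeCLM H f i 1 t

/-- The symmetric Yosida approximation `λ² H(t) (H(t)² + λ²)⁻¹`. -/
noncomputable def yosidaCLM (l t : ℝ) : ℋ →L[ℂ] ℋ :=
  ((l ^ 2 / 2 : ℝ) : ℂ) • (resolventCLM H f l t + resolventCLM H f (-l) t)

end

namespace IsKatoFamily

variable {ℋ : Type*} [NormedAddCommGroup ℋ] [InnerProductSpace ℂ ℋ] [CompleteSpace ℋ] {n : ℕ}
  {D : Submodule ℂ ℋ} {H : Fin n → D →ₗ[ℂ] ℋ} {f : Fin n → ℝ → ℝ} {I : Set ℝ}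

section

variable (hH : IsKatoFamily H f I) {l : ℝ} (hl : l ≠ 0)
include hH

omit [CompleteSpace ℋ] in
theorem continuousOn_coeff (i : Fin n) : ContinuousOn (f i) I :=
  fun t ht => (hH.hasDeriv i t ht).continuousWithinAt

include hl

theorem resolventCLM_apply {t : ℝ} (ht : t ∈ I) (z : ℋ) :
    resolventCLM H f l t z = imagResolvent (hamiltonianMap H f t) l z :=
  LinearMap.toBounded_apply (C := |l|⁻¹)
    (fun z => (hH.selfAdjoint t ht).norm_imagResolvent_le hl z) z

theorem norm_resolventCLM_le {t : ℝ} (ht : t ∈ I) : ‖resolventCLM H f l t‖ ≤ |l|⁻¹ :=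
  ContinuousLinearMap.opNorm_le_bound _ (by positivity) fun z => by
    rw [hH.resolventCLM_apply hl ht]
    exact (hH.selfAdjoint t ht).norm_imagResolvent_le hl z

theorem exists_relative_bound (i : Fin n) : ∃ K : ℝ, 0 ≤ K ∧ ∀ t ∈ I, ∀ z : ℋ,
    ‖H i (imagResolvent (hamiltonianMap H f t) l z)‖ ≤ K * ‖z‖ := by
  obtain ⟨K, hK, h⟩ := hH.bound i
  refine ⟨K * (1 + |l|⁻¹), by positivity, fun t ht z => ?_⟩
  calc _ ≤ _ := h t ht _
    _ ≤ K * (‖z‖ + |l|⁻¹ * ‖z‖) := by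
      gcongr
      · exact (hH.selfAdjoint t ht).norm_apply_imagResolvent_le hl z
      · exact (hH.selfAdjoint t ht).norm_imagResolvent_le hl z
    _ = _ := by ring

theorem relativeCLM_apply (i : Fin n) {t : ℝ} (ht : t ∈ I) (z : ℋ) :
    relativeCLM H f i l t z = H i (imagResolvent (hamiltonianMap H f t) l z) := by
  obtain ⟨K, -, h⟩ := hH.exists_relative_bound hl i
  exact LinearMap.toBounded_apply (C := K) (h t ht) z

theorem exists_norm_relativeCLM_le (i : Fin n) :
    ∃ K : ℝ, ∀ t ∈ I, ‖relativeCLM H f i l t‖ ≤ K := by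
  obtain ⟨K, hK, h⟩ := hH.exists_relative_bound hl i
  refine ⟨K, fun t ht => ContinuousLinearMap.opNorm_le_bound _ hK fun z => ?_⟩
  rw [hH.relativeCLM_apply hl i ht]
  exact h t ht z

/-- The second resolvent identity: apply `H(r) + iλ` to `y = R(t)z`, then invert. It is kept in `D`,
so that both the inclusion and each `H i` can be applied to it. -/
theorem imagResolvent_sub {t r : ℝ} (ht : t ∈ I) (hr : r ∈ I) (z : ℋ) :
    imagResolvent (hamiltonianMap H f r) l z - imagResolvent (hamiltonianMap H f t) l z =
      -∑ j, ((f j r - f j t : ℝ) : ℂ) •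
        imagResolvent (hamiltonianMap H f r) l (relativeCLM H f j l t z) := by
  set y := imagResolvent (hamiltonianMap H f t) l z with hy
  have h1 := (hH.selfAdjoint t ht).apply_imagResolvent hl z
  have h2 := (hH.selfAdjoint r hr).imagResolvent_apply_add hl y
  have h3 : hamiltonianMap H f r y + ((l : ℂ) * Complex.I) • (y : ℋ) =
      z + ∑ j, ((f j r - f j t : ℝ) : ℂ) • relativeCLM H f j l t z := by
    rw [← hy] at h1
    have h4 : hamiltonianMap H f r y + ((l : ℂ) * Complex.I) • (y : ℋ) =
        z + (hamiltonianMap H f r y - hamiltonianMap H f t y) := by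
      rw [← h1]
      abel
    rw [h4]
    congr 1
    simp only [hH.relativeCLM_apply hl _ ht, ← hy, Complex.ofReal_sub, sub_smul,
      Finset.sum_sub_distrib, LinearMap.sum_apply, LinearMap.smul_apply]
  rw [h3, map_add, map_sum] at h2
  simp only [map_smul] at h2
  rw [← h2]
  abel

theorem resolventCLM_sub {t r : ℝ} (ht : t ∈ I) (hr : r ∈ I) :
    resolventCLM H f l r - resolventCLM H f l t =
      -∑ j, ((f j r - f j t : ℝ) : ℂ) • (resolventCLM H f l r ∘L relativeCLM H f j l t) := by
  ext z
  have := congrArg (D.subtype) (hH.imagResolvent_sub hl ht hr z)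
  simpa [_root_.sum_apply, hH.resolventCLM_apply hl ht,
    hH.resolventCLM_apply hl hr] using this

theorem relativeCLM_sub (i : Fin n) {t r : ℝ} (ht : t ∈ I) (hr : r ∈ I) :
    relativeCLM H f i l r - relativeCLM H f i l t =
      -∑ j, ((f j r - f j t : ℝ) : ℂ) • (relativeCLM H f i l r ∘L relativeCLM H f j l t) := by
  ext z
  have := congrArg (H i) (hH.imagResolvent_sub hl ht hr z)
  simpa [_root_.sum_apply, hH.relativeCLM_apply hl i ht,
    hH.relativeCLM_apply hl i hr] using this

theorem continuousOn_resolventCLM : ContinuousOn (resolventCLM H f l) I := by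
  choose K hK using hH.exists_norm_relativeCLM_le hl
  exact continuousOn_of_sub_eq_neg_sum (fun t ht => hH.norm_resolventCLM_le hl ht) hK
    hH.continuousOn_coeff fun t ht r hr => hH.resolventCLM_sub hl ht hr

theorem continuousOn_relativeCLM (i : Fin n) : ContinuousOn (relativeCLM H f i l) I := by
  choose K hK using hH.exists_norm_relativeCLM_le hl
  exact continuousOn_of_sub_eq_neg_sum (hK i) hK
    hH.continuousOn_coeff fun t ht r hr => hH.relativeCLM_sub hl i ht hr

theorem continuousOn_yosidaCLM : ContinuousOn (yosidaCLM H f l) I :=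
  ((hH.continuousOn_resolventCLM hl).add
    (hH.continuousOn_resolventCLM (neg_ne_zero.2 hl))).const_smul ((l ^ 2 / 2 : ℝ) : ℂ)

/-- Passing to the adjoint exchanges the resolvents at `λ` and `-λ`, and their sum is invariant. -/
theorem inner_yosidaCLM {t : ℝ} (ht : t ∈ I) (x y : ℋ) :
    inner ℂ (yosidaCLM H f l t x) y = inner ℂ x (yosidaCLM H f l t y) := by
  have h1 := (hH.selfAdjoint t ht).inner_imagResolvent hl x y
  have h2 := (hH.selfAdjoint t ht).inner_imagResolvent (neg_ne_zero.2 hl) x y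
  rw [neg_neg] at h2
  simp only [yosidaCLM, _root_.smul_apply, _root_.add_apply,
    inner_smul_left, inner_smul_right, inner_add_left, inner_add_right, Complex.conj_ofReal,
    hH.resolventCLM_apply hl ht, hH.resolventCLM_apply (neg_ne_zero.2 hl) ht, h1, h2]
  ring

theorem yosidaCLM_resolventCLM {t : ℝ} (ht : t ∈ I) (z : ℋ) :
    yosidaCLM H f l t (resolventCLM H f 1 t z) = resolventCLM H f 1 t (yosidaCLM H f l t z) := by
  have hs := hH.selfAdjoint t ht
  have h1 := congrArg D.subtype (hs.imagResolvent_comm hl one_ne_zero z)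
  have h2 := congrArg D.subtype (hs.imagResolvent_comm (neg_ne_zero.2 hl) one_ne_zero z)
  simp only [Submodule.subtype_apply] at h1 h2
  simp only [yosidaCLM, _root_.smul_apply, _root_.add_apply, map_smul,
    map_add, hH.resolventCLM_apply hl ht, hH.resolventCLM_apply (neg_ne_zero.2 hl) ht,
    hH.resolventCLM_apply one_ne_zero ht, h1, h2, Submodule.coe_smul, Submodule.coe_add]

/-- From `R T y = y - iλ R y` at `λ` and `-λ`, the two copies of `y` cancel. One factor `λ` is
traded for `T`, which makes the bound by `‖T y‖` uniform in `λ`. -/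
theorem yosidaCLM_apply_mem {t : ℝ} (ht : t ∈ I) (y : D) :
    yosidaCLM H f l t y = ((l / 2 : ℝ) * Complex.I : ℂ) •
      ((imagResolvent (hamiltonianMap H f t) l (hamiltonianMap H f t y) : ℋ) -
        imagResolvent (hamiltonianMap H f t) (-l) (hamiltonianMap H f t y)) := by
  have hs := hH.selfAdjoint t ht
  have h1 := congrArg D.subtype (hs.imagResolvent_apply hl y)
  have h2 := congrArg D.subtype (hs.imagResolvent_apply (neg_ne_zero.2 hl) y)
  simp only [Submodule.subtype_apply, Submodule.coe_sub, Submodule.coe_smul] at h1 h2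
  rw [h1, h2]
  simp only [yosidaCLM, _root_.smul_apply, _root_.add_apply,
    hH.resolventCLM_apply hl ht, hH.resolventCLM_apply (neg_ne_zero.2 hl) ht]
  generalize (imagResolvent (hamiltonianMap H f t) l (y : ℋ) : ℋ) = a
  generalize (imagResolvent (hamiltonianMap H f t) (-l) (y : ℋ) : ℋ) = b
  have : (((l ^ 2 / 2 : ℝ) : ℂ)) = -(((l / 2 : ℝ) : ℂ) * Complex.I * (l * Complex.I)) := by
    push_cast
    linear_combination ((l : ℂ) ^ 2 / 2) * Complex.I_mul_I
  rw [this]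
  push_cast
  module

theorem norm_yosidaCLM_apply_le {t : ℝ} (ht : t ∈ I) (y : D) :
    ‖yosidaCLM H f l t y‖ ≤ ‖hamiltonianMap H f t y‖ := by
  have hs := hH.selfAdjoint t ht
  have h1 := hs.norm_imagResolvent_le hl (hamiltonianMap H f t y)
  have h2 := hs.norm_imagResolvent_le (neg_ne_zero.2 hl) (hamiltonianMap H f t y)
  rw [abs_neg] at h2
  rw [hH.yosidaCLM_apply_mem hl ht, norm_smul, norm_mul, Complex.norm_real, Complex.norm_I,
    Real.norm_eq_abs, abs_div, mul_one]
  have h3 := norm_sub_le (imagResolvent (hamiltonianMap H f t) l (hamiltonianMap H f t y) : ℋ)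
    (imagResolvent (hamiltonianMap H f t) (-l) (hamiltonianMap H f t y))
  have hl' := abs_pos.2 hl
  calc _ ≤ |l| / |2| * (|l|⁻¹ * ‖hamiltonianMap H f t y‖ + |l|⁻¹ * ‖hamiltonianMap H f t y‖) := by
        gcongr
        linarith
    _ = _ := by
        rw [abs_two]
        field_simp
        ring

/-- `T y - Y y` equals `T w` with `‖w‖ ≤ |λ|⁻¹ ‖T y‖`. Moving `T` onto `x` gives a rate `1/λ` that
needs only `x, y ∈ D`, not `T y ∈ D`. -/
theorem norm_inner_sub_yosidaCLM_le {t : ℝ} (ht : t ∈ I) (x y : D) :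
    ‖inner ℂ (x : ℋ) (hamiltonianMap H f t y) - inner ℂ (x : ℋ) (yosidaCLM H f l t y)‖ ≤
      |l|⁻¹ * (‖hamiltonianMap H f t x‖ * ‖hamiltonianMap H f t y‖) := by
  have hs := hH.selfAdjoint t ht
  have hY := hH.yosidaCLM_apply_mem hl ht y
  set T := hamiltonianMap H f t
  set z := T y
  have e1 := hs.apply_imagResolvent hl z
  have e2 := hs.apply_imagResolvent (neg_ne_zero.2 hl) z
  have h1 := hs.norm_imagResolvent_le hl z
  have h2 := hs.norm_imagResolvent_le (neg_ne_zero.2 hl) z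
  rw [abs_neg] at h2
  have key : z - yosidaCLM H f l t y =
      T (((1 / 2 : ℝ) : ℂ) • (imagResolvent T l z + imagResolvent T (-l) z)) := by
    rw [hY, map_smul, map_add]
    push_cast at e2 ⊢
    linear_combination (norm := module) (-(1 / 2 : ℂ)) • e1 + (-(1 / 2 : ℂ)) • e2
  rw [← inner_sub_right, key, ← hs.symm]
  have h3 := norm_add_le (imagResolvent T l z : ℋ) (imagResolvent T (-l) z)
  calc _ ≤ ‖T x‖ * ‖((((1 / 2 : ℝ) : ℂ) •
        (imagResolvent T l z + imagResolvent T (-l) z) : D) : ℋ)‖ := norm_inner_le_norm _ _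
    _ ≤ ‖T x‖ * (1 / 2 * (|l|⁻¹ * ‖z‖ + |l|⁻¹ * ‖z‖)) := by
      rw [Submodule.coe_smul, norm_smul, Complex.norm_real, Submodule.coe_add]
      norm_num
      gcongr
      linarith
    _ = _ := by ring

end

theorem continuousOn_derivRelativeCLM (hH : IsKatoFamily H f I) :
    ContinuousOn (derivRelativeCLM H f I) I :=
  continuousOn_finsetSum _ fun i _ =>
    (Complex.continuous_ofReal.comp_continuousOn (hH.continuous_deriv i)).smul
      (hH.continuousOn_relativeCLM one_ne_zero i)

theorem hasDerivWithinAt_resolventCLM (hH : IsKatoFamily H f I) {t : ℝ} (ht : t ∈ I) :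
    HasDerivWithinAt (resolventCLM H f 1)
      (-(resolventCLM H f 1 t ∘L derivRelativeCLM H f I t)) I t := by
  have := hasDerivWithinAt_of_sub_eq_neg_sum (hH.continuousOn_resolventCLM one_ne_zero) ht
    (fun j => hH.hasDeriv j t ht) fun r hr => hH.resolventCLM_sub one_ne_zero ht hr
  convert this using 2
  ext z
  simp [derivRelativeCLM]

end IsKatoFamily

/-! ### Evolutions generated by the Yosida approximations. -/

/-- `u t s x` is the solution at time `t` of `u' = -i Y(t) u` with value `x` at time `s`, where
`Y` is the Yosida approximation of parameter `l` of the Hamiltonian. -/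
structure IsYosidaEvolution {ℋ : Type*} [NormedAddCommGroup ℋ] [InnerProductSpace ℂ ℋ] {n : ℕ}
    {D : Submodule ℂ ℋ} (H : Fin n → D →ₗ[ℂ] ℋ) (f : Fin n → ℝ → ℝ) (I : Set ℝ) (l : ℝ)
    (u : ℝ → ℝ → ℋ → ℋ) : Prop where
  refl : ∀ s ∈ I, ∀ x, u s s x = x
  hasDeriv : ∀ s ∈ I, ∀ x, ∀ t ∈ I, HasDerivWithinAt (fun t => u t s x)
    ((-Complex.I • yosidaCLM H f l t) (u t s x)) I t

namespace IsKatoFamily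

variable {ℋ : Type*} [NormedAddCommGroup ℋ] [InnerProductSpace ℂ ℋ] [CompleteSpace ℋ] {n : ℕ}
  {D : Submodule ℂ ℋ} {H : Fin n → D →ₗ[ℂ] ℋ} {f : Fin n → ℝ → ℝ} {I : Set ℝ}
  (hH : IsKatoFamily H f I) {l : ℝ} (hl : l ≠ 0)
include hH hl

theorem continuousOn_neg_I_smul_yosidaCLM :
    ContinuousOn (fun t => -Complex.I • yosidaCLM H f l t) I :=
  (hH.continuousOn_yosidaCLM hl).const_smul (-Complex.I)

theorem re_inner_yosidaCLM {t : ℝ} (ht : t ∈ I) (x : ℋ) :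
    (inner ℂ x ((-Complex.I • yosidaCLM H f l t) x)).re = 0 := by
  have h1 := hH.inner_yosidaCLM hl ht x x
  rw [← inner_conj_symm] at h1
  have h2 := Complex.conj_eq_iff_im.1 h1
  rw [_root_.smul_apply, inner_smul_right]
  simp [h2]

theorem exists_isYosidaEvolution : ∃ u, IsYosidaEvolution H f I l u := by
  have hex : ∀ s ∈ I, ∀ x₀ : ℋ, ∃ x : ℝ → ℋ, x s = x₀ ∧ ∀ t ∈ I,
      HasDerivWithinAt x ((-Complex.I • yosidaCLM H f l t) (x t)) I t :=
    fun s hs x₀ => exists_linear_ode_solution hH.ordConnected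
      (hH.continuousOn_neg_I_smul_yosidaCLM hl) hs x₀
  choose! x hx hx' using hex
  exact ⟨fun t s x₀ => x s x₀ t, hx, hx'⟩

end IsKatoFamily

namespace IsYosidaEvolution

variable {ℋ : Type*} [NormedAddCommGroup ℋ] [InnerProductSpace ℂ ℋ] [CompleteSpace ℋ] {n : ℕ}
  {D : Submodule ℂ ℋ} {H : Fin n → D →ₗ[ℂ] ℋ} {f : Fin n → ℝ → ℝ} {I : Set ℝ}
  {l : ℝ} {u : ℝ → ℝ → ℋ → ℋ} (hu : IsYosidaEvolution H f I l u)
  (hH : IsKatoFamily H f I) (hl : l ≠ 0) {s t : ℝ} (hs : s ∈ I) (ht : t ∈ I)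
include hu hH hl hs ht

theorem norm_apply (x : ℋ) : ‖u t s x‖ = ‖x‖ := by
  have h : ∀ a ∈ I, ∀ b ∈ I, ‖u b s x‖ ≤ ‖u a s x‖ := by
    intro a ha b hb
    have hsub := hH.ordConnected.uIcc_subset ha hb
    have := norm_le_exp_mul_norm_of_abs_re_inner_le (s := a) (t := b) (c := 0)
      (fun r hr => (hu.hasDeriv s hs x r (hsub hr)).mono hsub)
      (fun r hr => by rw [hH.re_inner_yosidaCLM hl (hsub hr)]; simp)
    simpa using this
  have h1 := h s hs t ht
  have h2 := h t ht s hs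
  rw [hu.refl s hs] at h1 h2
  exact le_antisymm h1 h2

theorem eq_apply {x : ℝ → ℋ} (hx : ∀ t ∈ I,
    HasDerivWithinAt x ((-Complex.I • yosidaCLM H f l t) (x t)) I t) : x t = u t s (x s) :=
  eqOn_of_linear_ode hH.ordConnected (hH.continuousOn_neg_I_smul_yosidaCLM hl) hs hx
    (hu.hasDeriv s hs (x s)) (hu.refl s hs _).symm ht

theorem add_apply (x y : ℋ) : u t s (x + y) = u t s x + u t s y := by
  have := hu.eq_apply hH hl hs ht (x := fun t => u t s x + u t s y) fun r hr => by
    rw [map_add]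
    exact (hu.hasDeriv s hs x r hr).add (hu.hasDeriv s hs y r hr)
  simpa only [hu.refl s hs] using this.symm

theorem smul_apply (c : ℂ) (x : ℋ) : u t s (c • x) = c • u t s x := by
  have := hu.eq_apply hH hl hs ht (x := fun t => c • u t s x) fun r hr => by
    rw [map_smul]
    exact (hu.hasDeriv s hs x r hr).const_smul c
  simpa only [hu.refl s hs] using this.symm

theorem norm_sub_apply (x y : ℋ) : ‖u t s x - u t s y‖ = ‖x - y‖ := by
  have h : u t s (x - y) = u t s x - u t s y := by
    have := hu.add_apply hH hl hs ht (x - y) y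
    rw [sub_add_cancel] at this
    exact eq_sub_of_add_eq this.symm
  rw [← h, hu.norm_apply hH hl hs ht]

theorem comp_apply {r : ℝ} (hr : r ∈ I) (x : ℋ) : u t s (u s r x) = u t r x :=
  (hu.eq_apply hH hl hs ht (x := fun t => u t r x) (hu.hasDeriv r hr x)).symm

/-- The approximating evolutions preserve the domain, with uniform control of the graph norms. -/
theorem exists_mem_norm_sq_add_le {c : ℝ}
    (hc : ∀ r ∈ uIcc s t, ‖derivRelativeCLM H f I r‖ ≤ c) (y : D) :
    ∃ h : u t s y ∈ D, ‖hamiltonianMap H f t ⟨u t s y, h⟩‖ ^ 2 + ‖(y : ℋ)‖ ^ 2 ≤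
      Real.exp (2 * c * |t - s|) * (‖hamiltonianMap H f s y‖ ^ 2 + ‖(y : ℋ)‖ ^ 2) := by
  have hsub := hH.ordConnected.uIcc_subset hs ht
  -- `Φ` stands for `(H(t) + i) u(t,s) y`. Since membership in `D` is not yet known, the equation
  -- this expression ought to satisfy is solved first.
  obtain ⟨Φ, hΦs, hΦ⟩ := exists_linear_ode_solution hH.ordConnected
    (A := fun t => -Complex.I • yosidaCLM H f l t + derivRelativeCLM H f I t)
    ((hH.continuousOn_neg_I_smul_yosidaCLM hl).add hH.continuousOn_derivRelativeCLM) hs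
    (hamiltonianMap H f s y + (((1 : ℝ) : ℂ) * Complex.I) • (y : ℋ))
  -- In the derivative of `R Φ` the term `-R B Φ` from `R'` cancels `R B Φ` from `Φ'`; commuting `Y`
  -- with `R` leaves the Yosida equation.
  have hR := hu.eq_apply hH hl hs ht (x := fun t => resolventCLM H f 1 t (Φ t)) fun r hr => by
    have h1 := (hH.hasDerivWithinAt_resolventCLM hr).complex_clm_apply (hΦ r hr)
    convert h1 using 1
    simp only [_root_.smul_apply, _root_.add_apply, _root_.neg_apply, map_add, map_smul,
      hH.yosidaCLM_resolventCLM hl hr, ContinuousLinearMap.comp_apply]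
    abel
  have hRs : resolventCLM H f 1 s (Φ s) = y := by
    rw [hH.resolventCLM_apply one_ne_zero hs, hΦs,
      (hH.selfAdjoint s hs).imagResolvent_apply_add one_ne_zero]
  -- The part `-iY` is skew and drops out, so the growth rate is independent of `l`.
  have hΦt : ‖Φ t‖ ≤ Real.exp (c * |t - s|) * ‖Φ s‖ := by
    refine norm_le_exp_mul_norm_of_abs_re_inner_le
      (fun r hr => (hΦ r (hsub hr)).mono hsub) fun r hr => ?_
    rw [_root_.add_apply, inner_add_right, Complex.add_re,
      hH.re_inner_yosidaCLM hl (hsub hr), zero_add]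
    calc _ ≤ ‖inner ℂ (Φ r) (derivRelativeCLM H f I r (Φ r))‖ := Complex.abs_re_le_norm _
      _ ≤ ‖Φ r‖ * ‖derivRelativeCLM H f I r (Φ r)‖ := norm_inner_le_norm _ _
      _ ≤ ‖Φ r‖ * (c * ‖Φ r‖) := by
        gcongr
        exact ContinuousLinearMap.le_of_opNorm_le _ (hc r hr) _
      _ = _ := by ring
  have hnorm := hu.norm_apply hH hl hs ht (y : ℋ)
  simp only [hRs] at hR
  rw [← hR, hH.resolventCLM_apply one_ne_zero ht] at hnorm ⊢
  refine ⟨Submodule.coe_mem _, ?_⟩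
  have h1 := (hH.selfAdjoint t ht).norm_sq_add 1 (imagResolvent (hamiltonianMap H f t) 1 (Φ t))
  rw [(hH.selfAdjoint t ht).apply_imagResolvent one_ne_zero] at h1
  have h2 := (hH.selfAdjoint s hs).norm_sq_add 1 y
  rw [← hΦs] at h2
  rw [hnorm, one_pow, one_mul] at h1
  rw [one_pow, one_mul] at h2
  rw [Subtype.coe_eta, ← h1, ← h2]
  calc ‖Φ t‖ ^ 2 ≤ (Real.exp (c * |t - s|) * ‖Φ s‖) ^ 2 := by gcongr
    _ = _ := by
      rw [mul_pow, ← Real.exp_nat_mul]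
      push_cast
      ring_nf

omit ht in
theorem exists_mem_norm_sq_add_le_of_mem_uIcc (ht : t ∈ I) {c : ℝ}
    (hc : ∀ r ∈ uIcc s t, ‖derivRelativeCLM H f I r‖ ≤ c) (y : D) {r : ℝ} (hr : r ∈ uIcc s t) :
    ∃ h : u r s y ∈ D, ‖hamiltonianMap H f r ⟨u r s y, h⟩‖ ^ 2 + ‖(y : ℋ)‖ ^ 2 ≤
      Real.exp (2 * c * |t - s|) * (‖hamiltonianMap H f s y‖ ^ 2 + ‖(y : ℋ)‖ ^ 2) := by
  have hsub := hH.ordConnected.uIcc_subset hs ht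
  have hc0 : 0 ≤ c := (norm_nonneg _).trans (hc r hr)
  obtain ⟨h, hle⟩ := hu.exists_mem_norm_sq_add_le hH hl hs (hsub hr)
    (fun q hq => hc q (uIcc_subset_uIcc left_mem_uIcc hr hq)) y
  refine ⟨h, hle.trans ?_⟩
  have : |r - s| ≤ |t - s| := abs_sub_left_of_mem_uIcc hr
  gcongr

/-- The conserved quantity `‖y‖²` is subtracted under the root so that the bound, divided by `|t -
s|`, tends exactly to `‖H(s)y‖`; a cruder constant would not give norm convergence of the difference
quotients. -/
theorem norm_sub_le {c : ℝ} (hc : ∀ r ∈ uIcc s t, ‖derivRelativeCLM H f I r‖ ≤ c) (y : D) :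
    ‖u t s y - y‖ ≤ √(Real.exp (2 * c * |t - s|) *
      (‖hamiltonianMap H f s y‖ ^ 2 + ‖(y : ℋ)‖ ^ 2) - ‖(y : ℋ)‖ ^ 2) * |t - s| := by
  have hsub := hH.ordConnected.uIcc_subset hs ht
  have := (convex_uIcc s t).norm_image_sub_le_of_norm_hasDerivWithin_le
    (fun r hr => (hu.hasDeriv s hs y r (hsub hr)).mono hsub)
    (C := √(Real.exp (2 * c * |t - s|) *
      (‖hamiltonianMap H f s y‖ ^ 2 + ‖(y : ℋ)‖ ^ 2) - ‖(y : ℋ)‖ ^ 2))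
    (fun r hr => by
      obtain ⟨h, hle⟩ := hu.exists_mem_norm_sq_add_le_of_mem_uIcc hH hl hs ht hc y hr
      rw [_root_.smul_apply, norm_smul, norm_neg, Complex.norm_I, one_mul]
      refine (hH.norm_yosidaCLM_apply_le hl (hsub hr) ⟨_, h⟩).trans (Real.le_sqrt_of_sq_le ?_)
      linarith) left_mem_uIcc right_mem_uIcc
  rwa [hu.refl s hs, Real.norm_eq_abs] at this

/-- Two approximating evolutions with large parameters are close on the domain. -/
theorem norm_sub_sq_le {m : ℝ} (hm : m ≠ 0) {v : ℝ → ℝ → ℋ → ℋ}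
    (hv : IsYosidaEvolution H f I m v) {c : ℝ}
    (hc : ∀ r ∈ uIcc s t, ‖derivRelativeCLM H f I r‖ ≤ c) (y : D) :
    ‖u t s y - v t s y‖ ^ 2 ≤ 2 * ((|l|⁻¹ + |m|⁻¹) * (Real.exp (2 * c * |t - s|) *
      (‖hamiltonianMap H f s y‖ ^ 2 + ‖(y : ℋ)‖ ^ 2)) * |t - s|) := by
  have hsub := hH.ordConnected.uIcc_subset hs ht
  set G := Real.exp (2 * c * |t - s|) * (‖hamiltonianMap H f s y‖ ^ 2 + ‖(y : ℋ)‖ ^ 2) with hG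
  have hmv := (convex_uIcc s t).norm_image_sub_le_of_norm_hasDerivWithin_le
    (fun r hr => ((hu.hasDeriv s hs y r (hsub hr)).inner ℂ
      (hv.hasDeriv s hs y r (hsub hr))).mono hsub)
    (C := (|l|⁻¹ + |m|⁻¹) * G)
    (fun r hr => by
      obtain ⟨h1, hle1⟩ := hu.exists_mem_norm_sq_add_le_of_mem_uIcc hH hl hs ht hc y hr
      obtain ⟨h2, hle2⟩ := hv.exists_mem_norm_sq_add_le_of_mem_uIcc hH hm hs ht hc y hr
      rw [← hG] at hle1 hle2
      have e1 := hH.norm_inner_sub_yosidaCLM_le hl (hsub hr) ⟨_, h1⟩ ⟨_, h2⟩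
      have e2 := hH.norm_inner_sub_yosidaCLM_le hm (hsub hr) ⟨_, h1⟩ ⟨_, h2⟩
      set T := hamiltonianMap H f r
      set p := u r s y
      set q := v r s y
      have hpq : ‖T ⟨p, h1⟩‖ * ‖T ⟨q, h2⟩‖ ≤ G := by
        nlinarith [sq_nonneg (‖T ⟨p, h1⟩‖ - ‖T ⟨q, h2⟩‖), sq_nonneg ‖(y : ℋ)‖]
      -- Inserting `⟪p, T q⟫` with both signs turns the derivative of `⟪u, v⟫` into a difference of
      -- two Yosida errors.
      have e3 : inner ℂ p ((-Complex.I • yosidaCLM H f m r) q) +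
          inner ℂ ((-Complex.I • yosidaCLM H f l r) p) q = Complex.I *
          ((inner ℂ p (T ⟨q, h2⟩) - inner ℂ p (yosidaCLM H f m r q)) -
            (inner ℂ p (T ⟨q, h2⟩) - inner ℂ p (yosidaCLM H f l r q))) := by
        rw [_root_.smul_apply, _root_.smul_apply, inner_smul_left, inner_smul_right,
          hH.inner_yosidaCLM hl (hsub hr)]
        simp
        ring
      rw [e3, norm_mul, Complex.norm_I, one_mul]
      calc _ ≤ _ := _root_.norm_sub_le _ _
        _ ≤ |m|⁻¹ * (‖T ⟨p, h1⟩‖ * ‖T ⟨q, h2⟩‖) + |l|⁻¹ * (‖T ⟨p, h1⟩‖ * ‖T ⟨q, h2⟩‖) :=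
          add_le_add e2 e1
        _ ≤ |m|⁻¹ * G + |l|⁻¹ * G := by gcongr
        _ = _ := by ring)
    left_mem_uIcc right_mem_uIcc
  rw [hu.refl s hs, hv.refl s hs, Real.norm_eq_abs] at hmv
  -- Both evolutions are isometric, so `‖u - v‖² = 2‖y‖² - 2 Re ⟪u, v⟫`, and it is enough that `⟪u,
  -- v⟫` stays near `‖y‖²`.
  have h1 := norm_sub_sq (𝕜 := ℂ) (u t s y) (v t s y)
  rw [hu.norm_apply hH hl hs ht, hv.norm_apply hH hm hs ht] at h1
  have h2 := (Complex.abs_re_le_norm _).trans hmv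
  rw [Complex.sub_re, abs_le] at h2
  have h3 : (inner ℂ (y : ℋ) (y : ℋ)).re = ‖(y : ℋ)‖ ^ 2 := by
    simp [← Complex.ofReal_pow]
  simp only [RCLike.re_to_complex] at h1
  linarith [h2.1]

/-- A first order expansion tested on `x ∈ D`. Symmetry moves `H(r)` onto the fixed `x`; the errors
come from the Yosida approximation, from the variation of `H(r)x`, and from that of `u(r,s)y`. -/
theorem norm_inner_sub_le {c η : ℝ} (hc : ∀ r ∈ uIcc s t, ‖derivRelativeCLM H f I r‖ ≤ c)
    (x y : D) (hη : ∀ r ∈ uIcc s t, ‖hamiltonianMap H f r x - hamiltonianMap H f s x‖ ≤ η) :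
    ‖inner ℂ (x : ℋ) (u t s y - y) -
      ((t - s : ℝ) : ℂ) * inner ℂ (x : ℋ) (-Complex.I • hamiltonianMap H f s y)‖ ≤
    (|l|⁻¹ * ((‖hamiltonianMap H f s x‖ + η) * √(Real.exp (2 * c * |t - s|) *
      (‖hamiltonianMap H f s y‖ ^ 2 + ‖(y : ℋ)‖ ^ 2))) + (η * ‖(y : ℋ)‖ +
      ‖hamiltonianMap H f s x‖ * (√(Real.exp (2 * c * |t - s|) *
      (‖hamiltonianMap H f s y‖ ^ 2 + ‖(y : ℋ)‖ ^ 2)) * |t - s|))) * |t - s| := by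
  have hsub := hH.ordConnected.uIcc_subset hs ht
  set G := Real.exp (2 * c * |t - s|) * (‖hamiltonianMap H f s y‖ ^ 2 + ‖(y : ℋ)‖ ^ 2) with hG
  have hd : ∀ r ∈ uIcc s t, HasDerivWithinAt
      (fun r => inner ℂ (x : ℋ) (u r s y) -
        ((r - s : ℝ) : ℂ) * inner ℂ (x : ℋ) (-Complex.I • hamiltonianMap H f s y))
      (inner ℂ (x : ℋ) ((-Complex.I • yosidaCLM H f l r) (u r s y)) -
        inner ℂ (x : ℋ) (-Complex.I • hamiltonianMap H f s y)) (uIcc s t) r := by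
    intro r hr
    have h1 := ((hasDerivWithinAt_const r I (x : ℋ)).inner ℂ
      (hu.hasDeriv s hs y r (hsub hr))).mono hsub
    have h2 : HasDerivWithinAt (fun r : ℝ => ((r - s : ℝ) : ℂ)) 1 (uIcc s t) r := by
      simpa using (((hasDerivAt_id r).sub_const s).ofReal_comp).hasDerivWithinAt
    have h3 := h1.sub (h2.mul_const (inner ℂ (x : ℋ) (-Complex.I • hamiltonianMap H f s y)))
    simp only [inner_zero_left, add_zero, one_mul] at h3
    exact h3
  have hmv := (convex_uIcc s t).norm_image_sub_le_of_norm_hasDerivWithin_le hd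
    (C := |l|⁻¹ * ((‖hamiltonianMap H f s x‖ + η) * √G) +
      (η * ‖(y : ℋ)‖ + ‖hamiltonianMap H f s x‖ * (√G * |t - s|)))
    (fun r hr => by
      obtain ⟨h1, hle1⟩ := hu.exists_mem_norm_sq_add_le_of_mem_uIcc hH hl hs ht hc y hr
      rw [← hG] at hle1
      have hrs : |r - s| ≤ |t - s| := abs_sub_left_of_mem_uIcc hr
      have hc0 : 0 ≤ c := (norm_nonneg _).trans (hc r hr)
      have e1 := hH.norm_inner_sub_yosidaCLM_le hl (hsub hr) x ⟨_, h1⟩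
      have e2 : ‖hamiltonianMap H f r ⟨u r s y, h1⟩‖ ≤ √G :=
        Real.le_sqrt_of_sq_le (by linarith [sq_nonneg ‖(y : ℋ)‖])
      have e3 : ‖hamiltonianMap H f r x‖ ≤ ‖hamiltonianMap H f s x‖ + η := by
        have := norm_le_norm_add_norm_sub (hamiltonianMap H f s x) (hamiltonianMap H f r x)
        rw [norm_sub_rev] at this
        linarith [hη r hr]
      have e4 : ‖u r s y - y‖ ≤ √G * |t - s| := by
        refine (hu.norm_sub_le hH hl hs (hsub hr)
          (fun q hq => hc q (uIcc_subset_uIcc left_mem_uIcc hr hq)) y).trans ?_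
        gcongr
        rw [hG]
        refine (sub_le_self _ (sq_nonneg _)).trans ?_
        gcongr
      have e5 : inner ℂ (x : ℋ) (hamiltonianMap H f r ⟨u r s y, h1⟩) -
          inner ℂ (x : ℋ) (hamiltonianMap H f s y) =
          inner ℂ (hamiltonianMap H f r x - hamiltonianMap H f s x) (u r s y) +
          inner ℂ (hamiltonianMap H f s x) (u r s y - y) := by
        rw [← (hH.selfAdjoint r (hsub hr)).symm, ← (hH.selfAdjoint s hs).symm, inner_sub_left,
          inner_sub_right]
        ring
      have e6 : inner ℂ (x : ℋ) ((-Complex.I • yosidaCLM H f l r) (u r s y)) -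
          inner ℂ (x : ℋ) (-Complex.I • hamiltonianMap H f s y) = Complex.I *
          ((inner ℂ (x : ℋ) (hamiltonianMap H f r ⟨u r s y, h1⟩) -
            inner ℂ (x : ℋ) (yosidaCLM H f l r (u r s y))) -
            (inner ℂ (hamiltonianMap H f r x - hamiltonianMap H f s x) (u r s y) +
              inner ℂ (hamiltonianMap H f s x) (u r s y - y))) := by
        rw [← e5, _root_.smul_apply, inner_smul_right, inner_smul_right]
        ring
      have hη0 : 0 ≤ η := (norm_nonneg _).trans (hη r hr)
      rw [e6, norm_mul, Complex.norm_I, one_mul]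
      refine (_root_.norm_sub_le _ _).trans (add_le_add (e1.trans ?_)
        ((norm_add_le _ _).trans (add_le_add ?_ ?_)))
      · gcongr
      · refine (norm_inner_le_norm _ _).trans ?_
        rw [hu.norm_apply hH hl hs (hsub hr)]
        gcongr
        exact hη r hr
      · refine (norm_inner_le_norm _ _).trans ?_
        gcongr)
    left_mem_uIcc right_mem_uIcc
  rw [hu.refl s hs, Real.norm_eq_abs, sub_self s] at hmv
  refine le_of_eq_of_le (congrArg norm ?_) hmv
  rw [inner_sub_right]
  simp
  ring

end IsYosidaEvolution

/-! ### The limit of the approximating evolutions and its derivative at equal times. -/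

/-- Weak convergence tested on a dense subspace together with an upper bound on the norms implies
norm convergence. -/
theorem tendsto_of_tendsto_inner_of_norm_sq_le {ℋ α : Type*} [NormedAddCommGroup ℋ]
    [InnerProductSpace ℂ ℋ] {D : Submodule ℂ ℋ} (hD : Dense (D : Set ℋ)) {F : Filter α}
    {q : α → ℋ} {v : ℋ} (hq : ∀ x ∈ D, Tendsto (fun a => inner ℂ x (q a)) F (𝓝 (inner ℂ x v)))
    {E : α → ℝ} (hE : Tendsto E F (𝓝 (‖v‖ ^ 2))) (hqE : ∀ᶠ a in F, ‖q a‖ ^ 2 ≤ E a) :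
    Tendsto q F (𝓝 v) := by
  have hv : Tendsto (fun a => inner ℂ v (q a)) F (𝓝 (inner ℂ v v)) := by
    rw [Metric.tendsto_nhds]
    intro ε hε
    set K := ‖v‖ + 1 with hK
    have hK0 : 0 < K := by positivity
    obtain ⟨x, hx, hxv⟩ := hD.exists_dist_lt v (show 0 < ε / (4 * K) by positivity)
    have h1 := hE.eventually (gt_mem_nhds (show ‖v‖ ^ 2 < K ^ 2 by rw [hK]; gcongr; linarith))
    filter_upwards [hqE, h1, Metric.tendsto_nhds.1 (hq x hx) (ε / 2) (by positivity)] with a h2 h3 h4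
    have hqK : ‖q a‖ ≤ K := le_of_sq_le_sq (h2.trans h3.le) hK0.le
    rw [dist_eq_norm] at *
    have : inner ℂ v (q a) - inner ℂ v v =
        inner ℂ (v - x) (q a - v) + (inner ℂ x (q a) - inner ℂ x v) := by
      simp only [inner_sub_left, inner_sub_right]
      ring
    rw [this]
    calc _ ≤ ‖v - x‖ * ‖q a - v‖ + ‖inner ℂ x (q a) - inner ℂ x v‖ :=
          (norm_add_le _ _).trans (by gcongr; exact norm_inner_le_norm _ _)
      _ ≤ ε / (4 * K) * (K + K) + ‖inner ℂ x (q a) - inner ℂ x v‖ := by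
          gcongr
          exact (norm_sub_le _ _).trans (by gcongr; linarith)
      _ < ε / (4 * K) * (K + K) + ε / 2 := by gcongr
      _ = ε := by field_simp; ring
  -- This expression dominates `‖q - v‖²`, by expanding the square and using `‖q‖² ≤ E`.
  have hre : Tendsto (fun a => E a - 2 * (inner ℂ v (q a)).re + ‖v‖ ^ 2) F (𝓝 0) := by
    have h1 := (Complex.continuous_re.tendsto _).comp hv
    have h2 := (hE.sub (h1.const_mul 2)).add_const (‖v‖ ^ 2)
    have h3 : ‖v‖ ^ 2 - 2 * (inner ℂ v v).re + ‖v‖ ^ 2 = 0 := by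
      simp [← Complex.ofReal_pow]
      ring
    rwa [h3] at h2
  have hsq : Tendsto (fun a => ‖q a - v‖ ^ 2) F (𝓝 0) := by
    refine squeeze_zero' (Eventually.of_forall fun _ => by positivity) ?_ hre
    filter_upwards [hqE] with a ha
    have h1 := norm_sub_sq (𝕜 := ℂ) (q a) v
    rw [inner_re_symm (𝕜 := ℂ), RCLike.re_to_complex] at h1
    rw [h1]
    linarith
  rw [tendsto_iff_norm_sub_tendsto_zero]
  have := (Real.continuous_sqrt.tendsto 0).comp hsq
  simpa [Function.comp_def] using this

/-- A strong limit of approximating evolutions along Yosida parameters tending to infinity. -/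
structure IsYosidaLimit {ℋ : Type*} [NormedAddCommGroup ℋ] [InnerProductSpace ℂ ℋ] {n : ℕ}
    {D : Submodule ℂ ℋ} (H : Fin n → D →ₗ[ℂ] ℋ) (f : Fin n → ℝ → ℝ) (I : Set ℝ)
    (u : ℕ → ℝ → ℝ → ℋ → ℋ) (U : ℝ → ℝ → ℋ → ℋ) : Prop where
  evolution : ∀ k : ℕ, IsYosidaEvolution H f I ((k : ℝ) + 1) (u k)
  tendsto : ∀ s ∈ I, ∀ t ∈ I, ∀ x, Tendsto (fun k => u k t s x) atTop (𝓝 (U t s x))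

theorem abs_natCast_add_one_inv (k : ℕ) : |(k : ℝ) + 1|⁻¹ = 1 / ((k : ℝ) + 1) := by
  rw [abs_of_pos (by positivity), one_div]

namespace IsKatoFamily

variable {ℋ : Type*} [NormedAddCommGroup ℋ] [InnerProductSpace ℂ ℋ] [CompleteSpace ℋ] {n : ℕ}
  {D : Submodule ℂ ℋ} {H : Fin n → D →ₗ[ℂ] ℋ} {f : Fin n → ℝ → ℝ} {I : Set ℝ}
  (hH : IsKatoFamily H f I)
include hH

theorem exists_norm_derivRelativeCLM_le {s t : ℝ} (hs : s ∈ I) (ht : t ∈ I) :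
    ∃ c, ∀ r ∈ uIcc s t, ‖derivRelativeCLM H f I r‖ ≤ c :=
  isCompact_uIcc.exists_bound_of_continuousOn
    (hH.continuousOn_derivRelativeCLM.mono (hH.ordConnected.uIcc_subset hs ht))

/-- On `D` the squared distance of two approximations is at most a constant times the sum of their
inverse parameters; isometry and density extend the Cauchy property to all vectors. -/
theorem exists_isYosidaLimit : ∃ u U, IsYosidaLimit H f I u U := by
  have hk : ∀ k : ℕ, (k : ℝ) + 1 ≠ 0 := fun k => by positivity
  choose u hu using fun k : ℕ => hH.exists_isYosidaEvolution (hk k)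
  have hlim : ∀ s ∈ I, ∀ t ∈ I, ∀ x, ∃ z, Tendsto (fun k => u k t s x) atTop (𝓝 z) := by
    intro s hs t ht
    obtain ⟨c, hc⟩ := hH.exists_norm_derivRelativeCLM_le hs ht
    have hD : ∀ y : D, CauchySeq fun k => u k t s y := by
      intro y
      obtain ⟨B, hB0, hB⟩ : ∃ B : ℝ, 0 ≤ B ∧ ∀ k m : ℕ, ‖u k t s y - u m t s y‖ ^ 2 ≤
          (1 / ((k : ℝ) + 1) + 1 / ((m : ℝ) + 1)) * B := by
        refine ⟨2 * (Real.exp (2 * c * |t - s|) *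
          (‖hamiltonianMap H f s y‖ ^ 2 + ‖(y : ℋ)‖ ^ 2) * |t - s|), by positivity,
          fun k m => ?_⟩
        have := (hu k).norm_sub_sq_le hH (hk k) hs ht (hk m) (hu m) hc y
        rw [abs_natCast_add_one_inv, abs_natCast_add_one_inv] at this
        linarith
      rw [Metric.cauchySeq_iff]
      intro ε hε
      have h0 : Tendsto (fun N : ℕ => (1 / ((N : ℝ) + 1) + 1 / ((N : ℝ) + 1)) * B) atTop (𝓝 0) := by
        have := (tendsto_one_div_add_atTop_nhds_zero_nat (𝕜 := ℝ))
        simpa using (this.add this).mul_const B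
      obtain ⟨N, hN⟩ := (h0.eventually (gt_mem_nhds (show 0 < ε ^ 2 by positivity))).exists
      refine ⟨N, fun k hk' m hm' => ?_⟩
      rw [dist_eq_norm]
      refine lt_of_pow_lt_pow_left₀ 2 hε.le (((hB k m).trans ?_).trans_lt hN)
      gcongr
    have hcauchy : ∀ x, CauchySeq fun k => u k t s x := by
      intro x
      rw [Metric.cauchySeq_iff']
      intro ε hε
      obtain ⟨y, hy, hxy⟩ := (hH.selfAdjoint s hs).dense.exists_dist_lt x
        (show 0 < ε / 3 by positivity)
      obtain ⟨N, hN⟩ := Metric.cauchySeq_iff'.1 (hD ⟨y, hy⟩) (ε / 3) (by positivity)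
      refine ⟨N, fun k hk' => ?_⟩
      have h1 := hN k hk'
      have h2 := (hu k).norm_sub_apply hH (hk k) hs ht x y
      have h3 := (hu N).norm_sub_apply hH (hk N) hs ht y x
      rw [norm_sub_rev y x] at h3
      have h4 := dist_triangle4 (u k t s x) (u k t s y) (u N t s y) (u N t s x)
      rw [dist_eq_norm] at hxy
      rw [dist_eq_norm (u k t s x) (u k t s y), h2, dist_eq_norm (u N t s y), h3] at h4
      simp only at h1
      linarith
    exact fun x => cauchySeq_tendsto_of_complete (hcauchy x)
  choose! U hU using hlim
  exact ⟨u, fun t s x => U s t x, ⟨hu, hU⟩⟩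

end IsKatoFamily

namespace IsYosidaLimit

variable {ℋ : Type*} [NormedAddCommGroup ℋ] [InnerProductSpace ℂ ℋ] [CompleteSpace ℋ] {n : ℕ}
  {D : Submodule ℂ ℋ} {H : Fin n → D →ₗ[ℂ] ℋ} {f : Fin n → ℝ → ℝ} {I : Set ℝ}
  {u : ℕ → ℝ → ℝ → ℋ → ℋ} {U : ℝ → ℝ → ℋ → ℋ} (hU : IsYosidaLimit H f I u U)
  (hH : IsKatoFamily H f I)
include hU

omit [CompleteSpace ℋ] in
theorem refl {s : ℝ} (hs : s ∈ I) (x : ℋ) : U s s x = x := by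
  refine tendsto_nhds_unique (hU.tendsto s hs s hs x) ?_
  simp only [(hU.evolution _).refl s hs]
  exact tendsto_const_nhds

include hH

theorem norm_apply {s t : ℝ} (hs : s ∈ I) (ht : t ∈ I) (x : ℋ) : ‖U t s x‖ = ‖x‖ := by
  refine tendsto_nhds_unique (hU.tendsto s hs t ht x).norm ?_
  simp only [fun k : ℕ => (hU.evolution k).norm_apply hH (by positivity) hs ht x]
  exact tendsto_const_nhds

theorem add_apply {s t : ℝ} (hs : s ∈ I) (ht : t ∈ I) (x y : ℋ) :
    U t s (x + y) = U t s x + U t s y := by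
  refine tendsto_nhds_unique (hU.tendsto s hs t ht (x + y)) ?_
  simp only [fun k : ℕ => (hU.evolution k).add_apply hH (by positivity) hs ht x y]
  exact (hU.tendsto s hs t ht x).add (hU.tendsto s hs t ht y)

theorem smul_apply {s t : ℝ} (hs : s ∈ I) (ht : t ∈ I) (c : ℂ) (x : ℋ) :
    U t s (c • x) = c • U t s x := by
  refine tendsto_nhds_unique (hU.tendsto s hs t ht (c • x)) ?_
  simp only [fun k : ℕ => (hU.evolution k).smul_apply hH (by positivity) hs ht c x]
  exact (hU.tendsto s hs t ht x).const_smul c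

theorem comp_apply {r s t : ℝ} (hr : r ∈ I) (hs : s ∈ I) (ht : t ∈ I) (x : ℋ) :
    U t s (U s r x) = U t r x := by
  refine tendsto_nhds_unique ?_ (hU.tendsto r hr t ht x)
  have h1 := hU.tendsto s hs t ht (U s r x)
  -- Isometry of `u k t s` lets the inner argument be replaced by its limit.
  have h2 : Tendsto (fun k => u k t s (u k s r x) - u k t s (U s r x)) atTop (𝓝 0) := by
    rw [tendsto_zero_iff_norm_tendsto_zero]
    simp only [fun k : ℕ => (hU.evolution k).norm_sub_apply hH (by positivity) hs ht]
    exact tendsto_iff_norm_sub_tendsto_zero.1 (hU.tendsto r hr s hs x)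
  have h3 := h2.add h1
  simpa only [sub_add_cancel, zero_add,
    fun k : ℕ => (hU.evolution k).comp_apply hH (by positivity) hs ht hr x] using h3

/-- The uniform graph norm bound survives in `⟪U t s y, H(t) z⟫ = lim ⟪H(t) u k t s y, z⟫`. This
puts `U t s y` in the domain of the adjoint, which is `D`. -/
theorem mem_domain {s t : ℝ} (hs : s ∈ I) (ht : t ∈ I) (y : D) : U t s y ∈ D := by
  obtain ⟨c, hc⟩ := hH.exists_norm_derivRelativeCLM_le hs ht
  refine (hH.selfAdjoint t ht).mem_of_bound _ (√(Real.exp (2 * c * |t - s|) *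
    (‖hamiltonianMap H f s y‖ ^ 2 + ‖(y : ℋ)‖ ^ 2))) fun z => ?_
  have hlim : Tendsto (fun k => ‖inner ℂ (u k t s y) (hamiltonianMap H f t z)‖) atTop
      (𝓝 ‖inner ℂ (U t s y) (hamiltonianMap H f t z)‖) :=
    ((hU.tendsto s hs t ht y).inner tendsto_const_nhds).norm
  refine le_of_tendsto' hlim fun k => ?_
  obtain ⟨h, hle⟩ := (hU.evolution k).exists_mem_norm_sq_add_le hH (by positivity) hs ht hc y
  have h1 := (hH.selfAdjoint t ht).symm ⟨_, h⟩ z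
  simp only at h1
  rw [← h1]
  refine (norm_inner_le_norm _ _).trans ?_
  gcongr
  exact Real.le_sqrt_of_sq_le (by linarith [sq_nonneg ‖(y : ℋ)‖])

theorem norm_sub_le {s t c : ℝ} (hs : s ∈ I) (ht : t ∈ I)
    (hc : ∀ r ∈ uIcc s t, ‖derivRelativeCLM H f I r‖ ≤ c) (y : D) :
    ‖U t s y - y‖ ≤ √(Real.exp (2 * c * |t - s|) *
      (‖hamiltonianMap H f s y‖ ^ 2 + ‖(y : ℋ)‖ ^ 2) - ‖(y : ℋ)‖ ^ 2) * |t - s| :=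
  le_of_tendsto' ((hU.tendsto s hs t ht y).sub_const _).norm fun k =>
    (hU.evolution k).norm_sub_le hH (by positivity) hs ht hc y

theorem norm_inner_sub_le {s t c η : ℝ} (hs : s ∈ I) (ht : t ∈ I)
    (hc : ∀ r ∈ uIcc s t, ‖derivRelativeCLM H f I r‖ ≤ c)
    (x y : D) (hη : ∀ r ∈ uIcc s t, ‖hamiltonianMap H f r x - hamiltonianMap H f s x‖ ≤ η) :
    ‖inner ℂ (x : ℋ) (U t s y - y) -
      ((t - s : ℝ) : ℂ) * inner ℂ (x : ℋ) (-Complex.I • hamiltonianMap H f s y)‖ ≤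
    (η * ‖(y : ℋ)‖ + ‖hamiltonianMap H f s x‖ * (√(Real.exp (2 * c * |t - s|) *
      (‖hamiltonianMap H f s y‖ ^ 2 + ‖(y : ℋ)‖ ^ 2)) * |t - s|)) * |t - s| := by
  have hlim : Tendsto (fun k => ‖inner ℂ (x : ℋ) (u k t s y - y) -
      ((t - s : ℝ) : ℂ) * inner ℂ (x : ℋ) (-Complex.I • hamiltonianMap H f s y)‖) atTop
      (𝓝 ‖inner ℂ (x : ℋ) (U t s y - y) -
      ((t - s : ℝ) : ℂ) * inner ℂ (x : ℋ) (-Complex.I • hamiltonianMap H f s y)‖) :=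
    ((tendsto_const_nhds.inner ((hU.tendsto s hs t ht y).sub_const _)).sub_const _).norm
  have h0 := tendsto_one_div_add_atTop_nhds_zero_nat (𝕜 := ℝ)
  have h1 := ((h0.mul_const ((‖hamiltonianMap H f s x‖ + η) * √(Real.exp (2 * c * |t - s|) *
      (‖hamiltonianMap H f s y‖ ^ 2 + ‖(y : ℋ)‖ ^ 2)))).add_const (η * ‖(y : ℋ)‖ +
      ‖hamiltonianMap H f s x‖ * (√(Real.exp (2 * c * |t - s|) *
      (‖hamiltonianMap H f s y‖ ^ 2 + ‖(y : ℋ)‖ ^ 2)) * |t - s|))).mul_const |t - s|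
  rw [zero_mul, zero_add] at h1
  refine le_of_tendsto_of_tendsto' hlim h1 fun k => ?_
  have := (hU.evolution k).norm_inner_sub_le hH (by positivity) hs ht hc x y hη
  rwa [abs_natCast_add_one_inv] at this

/-- The difference quotients converge weakly against `D`, and their squared norms are at most a
quantity tending to `‖H(s)y‖²`, the squared norm of the candidate; hence they converge in norm. -/
theorem hasDerivWithinAt_diag {s : ℝ} (hs : s ∈ I) (y : D) :
    HasDerivWithinAt (fun t => U t s y) (-Complex.I • hamiltonianMap H f s y) I s := by
  set T := hamiltonianMap H f s
  obtain ⟨c, hc⟩ : ∃ c, ∀ᶠ t in 𝓝[I] s, ‖derivRelativeCLM H f I t‖ ≤ c := by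
    refine ⟨‖derivRelativeCLM H f I s‖ + 1, ?_⟩
    have := (hH.continuousOn_derivRelativeCLM s hs).norm
    filter_upwards [this.tendsto.eventually (gt_mem_nhds (lt_add_one _))] with t ht using ht.le
  -- properties holding near `s` hold on the whole segment between `s` and nearby points
  have hseg : ∀ P : ℝ → Prop, (∀ᶠ t in 𝓝[I] s, P t) →
      ∀ᶠ t in 𝓝[I \ {s}] s, t ∈ I ∧ t ≠ s ∧ ∀ r ∈ uIcc s t, P r := by
    intro P hP
    obtain ⟨δ, hδ, h⟩ := Metric.mem_nhdsWithin_iff.1 hP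
    have h2 : Metric.ball s δ ∈ 𝓝[I \ {s}] s := mem_nhdsWithin_of_mem_nhds (Metric.ball_mem_nhds s hδ)
    filter_upwards [h2, self_mem_nhdsWithin] with t ht ht'
    refine ⟨ht'.1, ht'.2, fun r hr => h ⟨?_, hH.ordConnected.uIcc_subset hs ht'.1 hr⟩⟩
    rw [Metric.mem_ball, Real.dist_eq] at ht ⊢
    exact (abs_sub_left_of_mem_uIcc hr).trans_lt ht
  have habs : Tendsto (fun t => |t - s|) (𝓝[I \ {s}] s) (𝓝 0) := by
    have : Tendsto (fun t : ℝ => |t - s|) (𝓝 s) (𝓝 |s - s|) :=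
      (continuous_id.sub continuous_const).abs.tendsto s
    rw [sub_self, abs_zero] at this
    exact this.mono_left nhdsWithin_le_nhds
  have hexp : Tendsto (fun t => Real.exp (2 * c * |t - s|)) (𝓝[I \ {s}] s) (𝓝 1) := by
    have := (Real.continuous_exp.tendsto _).comp (habs.const_mul (2 * c))
    rwa [mul_zero, Real.exp_zero] at this
  rw [hasDerivWithinAt_iff_tendsto_slope]
  have hslope : ∀ t, slope (fun t => U t s y) s t =
      (((t - s)⁻¹ : ℝ) : ℂ) • (U t s y - (y : ℋ)) := by
    intro t
    rw [slope_def_module, hU.refl hs, Complex.coe_smul]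
  refine tendsto_of_tendsto_inner_of_norm_sq_le (hH.selfAdjoint s hs).dense
    (E := fun t => Real.exp (2 * c * |t - s|) * (‖T y‖ ^ 2 + ‖(y : ℋ)‖ ^ 2) - ‖(y : ℋ)‖ ^ 2)
    ?_ ?_ ?_
  · intro x hx
    rw [Metric.tendsto_nhds]
    intro ε hε
    -- `η` bounds the variation of `H(r)x` near `s`; its contribution `η‖y‖` is all that survives as
    -- `t → s`.
    obtain ⟨η, hη, hηε⟩ : ∃ η : ℝ, 0 < η ∧ η * ‖(y : ℋ)‖ < ε := by
      refine ⟨ε / (‖(y : ℋ)‖ + 1), by positivity, ?_⟩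
      rw [div_mul_eq_mul_div, div_lt_iff₀ (by positivity)]
      nlinarith [norm_nonneg (y : ℋ)]
    have hTx : ∀ᶠ r in 𝓝[I] s, ‖hamiltonianMap H f r ⟨x, hx⟩ - T ⟨x, hx⟩‖ ≤ η := by
      have : ContinuousWithinAt (fun r => hamiltonianMap H f r ⟨x, hx⟩) I s := by
        simp only [LinearMap.sum_apply, LinearMap.smul_apply]
        refine tendsto_finsetSum _ fun i _ => ?_
        exact ((Complex.continuous_ofReal.tendsto _).comp
          (hH.continuousOn_coeff i s hs)).smul_const _
      have h1 := Metric.tendsto_nhds.1 this.tendsto η hη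
      filter_upwards [h1] with r hr
      rw [dist_eq_norm] at hr
      exact hr.le
    have hlim : Tendsto (fun t => η * ‖(y : ℋ)‖ + ‖T ⟨x, hx⟩‖ *
        (√(Real.exp (2 * c * |t - s|) * (‖T y‖ ^ 2 + ‖(y : ℋ)‖ ^ 2)) * |t - s|))
        (𝓝[I \ {s}] s) (𝓝 (η * ‖(y : ℋ)‖)) := by
      have h1 := (Real.continuous_sqrt.tendsto _).comp
        (hexp.mul_const (‖T y‖ ^ 2 + ‖(y : ℋ)‖ ^ 2))
      have h2 := ((h1.mul habs).const_mul ‖T ⟨x, hx⟩‖).const_add (η * ‖(y : ℋ)‖)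
      simpa using h2
    filter_upwards [hseg _ hc, hseg _ hTx, hlim.eventually (gt_mem_nhds hηε)] with t h1 h2 h3
    have h4 := hU.norm_inner_sub_le hH hs h1.1 h1.2.2 ⟨x, hx⟩ y h2.2.2
    have h5 : 0 < |t - s| := abs_pos.2 (sub_ne_zero.2 h1.2.1)
    have h6 : ((t - s : ℝ) : ℂ) ≠ 0 := by exact_mod_cast sub_ne_zero.2 h1.2.1
    refine lt_of_le_of_lt ?_ h3
    rw [hslope, dist_eq_norm, inner_smul_right, ← mul_le_mul_iff_left₀ h5]
    refine le_trans (le_of_eq ?_) h4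
    rw [mul_comm, ← Real.norm_eq_abs (t - s), ← Complex.norm_real, ← norm_mul, mul_sub, ← mul_assoc,
      Complex.ofReal_inv, mul_inv_cancel₀ h6, one_mul]
  · have := (hexp.mul_const (‖T y‖ ^ 2 + ‖(y : ℋ)‖ ^ 2)).sub_const (‖(y : ℋ)‖ ^ 2)
    convert this using 2
    rw [norm_smul, norm_neg, Complex.norm_I]
    ring
  · filter_upwards [hseg _ hc] with t h1
    have h4 := hU.norm_sub_le hH hs h1.1 h1.2.2 y
    have h5 : 0 < |t - s| := abs_pos.2 (sub_ne_zero.2 h1.2.1)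
    have hc0 : 0 ≤ c := (norm_nonneg _).trans (h1.2.2 s left_mem_uIcc)
    have h6 : 0 ≤ Real.exp (2 * c * |t - s|) * (‖T y‖ ^ 2 + ‖(y : ℋ)‖ ^ 2) - ‖(y : ℋ)‖ ^ 2 := by
      have : 1 ≤ Real.exp (2 * c * |t - s|) := Real.one_le_exp (by positivity)
      nlinarith [sq_nonneg ‖T y‖, sq_nonneg ‖(y : ℋ)‖]
    rw [hslope, norm_smul, Complex.norm_real, norm_inv, Real.norm_eq_abs]
    calc _ ≤ (|t - s|⁻¹ * (√(Real.exp (2 * c * |t - s|) * (‖T y‖ ^ 2 + ‖(y : ℋ)‖ ^ 2) -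
          ‖(y : ℋ)‖ ^ 2) * |t - s|)) ^ 2 := by gcongr
      _ = _ := by
        rw [mul_comm, mul_assoc, mul_inv_cancel₀ h5.ne', mul_one, Real.sq_sqrt h6]

end IsYosidaLimit

/-! ### Continuity and differentiability of the limit propagator in both times. -/

namespace IsYosidaLimit

variable {ℋ : Type*} [NormedAddCommGroup ℋ] [InnerProductSpace ℂ ℋ] [CompleteSpace ℋ] {n : ℕ}
  {D : Submodule ℂ ℋ} {H : Fin n → D →ₗ[ℂ] ℋ} {f : Fin n → ℝ → ℝ} {I : Set ℝ}
  {u : ℕ → ℝ → ℝ → ℋ → ℋ} {U : ℝ → ℝ → ℋ → ℋ} (hU : IsYosidaLimit H f I u U)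
  (hH : IsKatoFamily H f I)
include hU hH

theorem sub_apply {s t : ℝ} (hs : s ∈ I) (ht : t ∈ I) (x y : ℋ) :
    U t s (x - y) = U t s x - U t s y := by
  have := hU.add_apply hH hs ht (x - y) y
  rw [sub_add_cancel] at this
  exact eq_sub_of_add_eq this.symm

theorem tendsto_diag {s : ℝ} (hs : s ∈ I) (x : ℋ) :
    Tendsto (fun t => U t s x) (𝓝[I] s) (𝓝 x) := by
  rw [Metric.tendsto_nhds]
  intro ε hε
  obtain ⟨y, hy, hxy⟩ := (hH.selfAdjoint s hs).dense.exists_dist_lt x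
    (show 0 < ε / 3 by positivity)
  have h1 := (hU.hasDerivWithinAt_diag hH hs ⟨y, hy⟩).continuousWithinAt.tendsto
  simp only [hU.refl hs] at h1
  filter_upwards [Metric.tendsto_nhds.1 h1 (ε / 3) (by positivity), self_mem_nhdsWithin]
    with t h2 ht
  have h3 : dist (U t s x) (U t s y) = dist x y := by
    rw [dist_eq_norm, dist_eq_norm, ← hU.sub_apply hH hs ht, hU.norm_apply hH hs ht]
  have h4 := dist_triangle4 (U t s x) (U t s y) y x
  rw [h3, dist_comm y x] at h4
  linarith

theorem tendsto_left {s t : ℝ} (hs : s ∈ I) (ht : t ∈ I) (x : ℋ) :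
    Tendsto (fun r => U r s x) (𝓝[I] t) (𝓝 (U t s x)) := by
  refine (hU.tendsto_diag hH ht (U t s x)).congr' ?_
  filter_upwards [self_mem_nhdsWithin] with r hr
  exact hU.comp_apply hH hs ht hr x

theorem continuousOn_prod (x : ℋ) :
    ContinuousOn (fun p : ℝ × ℝ => U p.1 p.2 x) (I ×ˢ I) := by
  rintro ⟨t, s⟩ ⟨ht, hs⟩
  rw [ContinuousWithinAt, nhdsWithin_prod_eq]
  have h1 : Tendsto (fun p : ℝ × ℝ => U p.1 s x) (𝓝[I] t ×ˢ 𝓝[I] s) (𝓝 (U t s x)) :=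
    (hU.tendsto_left hH hs ht x).comp tendsto_fst
  -- Splits `U p.1 p.2 x` as `U p.1 p.2 (x - U p.2 s x) + U p.1 s x`; by isometry the first term is
  -- as small as its argument.
  have h2 : Tendsto (fun p : ℝ × ℝ => U p.1 p.2 (x - U p.2 s x)) (𝓝[I] t ×ˢ 𝓝[I] s) (𝓝 0) := by
    rw [tendsto_zero_iff_norm_tendsto_zero]
    have h3 : Tendsto (fun p : ℝ × ℝ => ‖x - U p.2 s x‖) (𝓝[I] t ×ˢ 𝓝[I] s) (𝓝 0) := by
      have := ((hU.tendsto_diag hH hs x).comp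
        (tendsto_snd (f := 𝓝[I] t))).const_sub x |>.norm
      rwa [sub_self, norm_zero] at this
    refine h3.congr' ?_
    filter_upwards [prod_mem_prod self_mem_nhdsWithin self_mem_nhdsWithin] with p hp
    rw [hU.norm_apply hH hp.2 hp.1]
  have h3 := h2.add h1
  rw [zero_add] at h3
  refine h3.congr' ?_
  filter_upwards [prod_mem_prod self_mem_nhdsWithin self_mem_nhdsWithin] with p hp
  rw [hU.sub_apply hH hp.2 hp.1, hU.comp_apply hH hs hp.2 hp.1, sub_add_cancel]

theorem hasDerivWithinAt_left {s t : ℝ} (hs : s ∈ I) (ht : t ∈ I) (y : D) :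
    HasDerivWithinAt (fun r => U r s y)
      (-Complex.I • hamiltonianMap H f t ⟨U t s y, hU.mem_domain hH hs ht y⟩) I t :=
  (hU.hasDerivWithinAt_diag hH ht ⟨U t s y, hU.mem_domain hH hs ht y⟩).congr
    (fun _ hr => (hU.comp_apply hH hs ht hr y).symm) (hU.comp_apply hH hs ht ht y).symm

/-- With `p = (t', s')`, the increment is `(U t' s y - U t s y) - U t' s' (U s' s y - y)`. The first
bracket is the derivative in the left variable; the second is the derivative at equal times,
transported by a strongly continuous isometry. -/
theorem differentiableOn_prod (y : D) :
    DifferentiableOn ℝ (fun p : ℝ × ℝ => U p.1 p.2 y) (I ×ˢ I) := by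
  rintro ⟨t, s⟩ ⟨ht, hs⟩
  set a := -Complex.I • hamiltonianMap H f t ⟨U t s y, hU.mem_domain hH hs ht y⟩
  set b := -Complex.I • hamiltonianMap H f s y
  let L : ℝ × ℝ →L[ℝ] ℋ := (ContinuousLinearMap.fst ℝ ℝ ℝ).smulRight a -
    (ContinuousLinearMap.snd ℝ ℝ ℝ).smulRight (U t s b)
  refine (HasFDerivWithinAt.of_isLittleO (f' := L) ?_).differentiableWithinAt
  have e1 : (fun r => U r s y - U t s y - (r - t) • a) =o[𝓝[I] t] fun r => r - t :=
    hasDerivWithinAt_iff_isLittleO.1 (hU.hasDerivWithinAt_left hH hs ht y)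
  have e2 := (hasDerivWithinAt_iff_isLittleO.1 (hU.hasDerivWithinAt_diag hH hs y))
  have e3 := hU.continuousOn_prod hH b (t, s) ⟨ht, hs⟩
  rw [ContinuousWithinAt] at e3
  rw [nhdsWithin_prod_eq] at e3 ⊢
  simp only [hU.refl hs] at e2
  have hfst : (fun p : ℝ × ℝ => p.1 - t) =O[𝓝[I] t ×ˢ 𝓝[I] s] fun p : ℝ × ℝ => p - (t, s) :=
    IsBigO.of_bound 1 (Eventually.of_forall fun p => by
      rw [one_mul]; exact norm_fst_le (p - (t, s)))
  have f1 := (e1.comp_tendsto (tendsto_fst (g := 𝓝[I] s))).trans_isBigO hfst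
  have hsnd : (fun p : ℝ × ℝ => p.2 - s) =O[𝓝[I] t ×ˢ 𝓝[I] s] fun p : ℝ × ℝ => p - (t, s) :=
    IsBigO.of_bound 1 (Eventually.of_forall fun p => by
      rw [one_mul]; exact norm_snd_le (p - (t, s)))
  have f2 := (e2.comp_tendsto (tendsto_snd (f := 𝓝[I] t))).trans_isBigO hsnd
  have f2' : (fun p : ℝ × ℝ => U p.1 p.2 (U p.2 s y - y - (p.2 - s) • b))
      =o[𝓝[I] t ×ˢ 𝓝[I] s] fun p : ℝ × ℝ => p - (t, s) := by
    refine IsBigO.trans_isLittleO (IsBigO.of_bound 1 ?_) f2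
    filter_upwards [prod_mem_prod self_mem_nhdsWithin self_mem_nhdsWithin] with p hp
    rw [one_mul, hU.norm_apply hH hp.2 hp.1]
    rfl
  -- Replacing `U t' s' b` by `U t s b` uses joint strong continuity, since `b` need not lie in `D`.
  have f3 : (fun p : ℝ × ℝ => (p.2 - s) • (U p.1 p.2 b - U t s b))
      =o[𝓝[I] t ×ˢ 𝓝[I] s] fun p : ℝ × ℝ => p - (t, s) := by
    have h1 : (fun p : ℝ × ℝ => U p.1 p.2 b - U t s b) =o[𝓝[I] t ×ˢ 𝓝[I] s] fun _ => (1 : ℝ) := by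
      rw [isLittleO_one_iff]
      have := e3.sub_const (U t s b)
      rwa [sub_self] at this
    have h2 := hsnd.norm_right.smul_isLittleO h1
    simpa using h2
  refine ((f1.sub f2').sub f3).congr' ?_ EventuallyEq.rfl
  filter_upwards [prod_mem_prod self_mem_nhdsWithin self_mem_nhdsWithin] with p hp
  have hsmul : U p.1 p.2 ((p.2 - s) • b) = (p.2 - s) • U p.1 p.2 b := by
    rw [← Complex.coe_smul, hU.smul_apply hH hp.2 hp.1, Complex.coe_smul]
  rw [hU.sub_apply hH hp.2 hp.1, hU.sub_apply hH hp.2 hp.1, hsmul,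
    hU.comp_apply hH hs hp.2 hp.1]
  simp only [Function.comp_apply, L, _root_.sub_apply,
    ContinuousLinearMap.smulRight_apply, ContinuousLinearMap.coe_fst', ContinuousLinearMap.coe_snd',
    Prod.fst_sub, Prod.snd_sub, smul_sub]
  abel

open Classical in
/-- The unitary operators given by a Yosida limit; the identity for times outside `I`. -/
noncomputable def unitary (t s : ℝ) : ℋ ≃ₗᵢ[ℂ] ℋ :=
  if h : s ∈ I ∧ t ∈ I then
    { toFun := U t s
      map_add' := hU.add_apply hH h.1 h.2
      map_smul' := hU.smul_apply hH h.1 h.2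
      invFun := U s t
      left_inv := fun x => by rw [hU.comp_apply hH h.1 h.2 h.1, hU.refl h.1]
      right_inv := fun x => by rw [hU.comp_apply hH h.2 h.1 h.2, hU.refl h.2]
      norm_map' := hU.norm_apply hH h.1 h.2 }
  else LinearIsometryEquiv.refl ℂ ℋ

theorem unitary_apply {s t : ℝ} (hs : s ∈ I) (ht : t ∈ I) (x : ℋ) :
    hU.unitary hH t s x = U t s x := by
  rw [unitary, dif_pos ⟨hs, ht⟩]
  rfl

end IsYosidaLimit

/-! ### From the stated hypotheses to the propagator. -/

theorem continuousOn_derivWithin_of_contDiffOn_one {I : Set ℝ} (hI : I.OrdConnected) {g : ℝ → ℝ}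
    (hg : ContDiffOn ℝ 1 g I) : ContinuousOn (derivWithin g I) I := by
  -- A one-point interval has no unique derivative, but continuity is then trivial; otherwise
  -- convexity and nonempty interior give unique differentiability.
  rcases I.subsingleton_or_nontrivial with h | h
  · exact h.continuousOn _
  · have hint : (interior I).Nonempty := by
      obtain ⟨a, ha, b, hb, hab⟩ := h.exists_lt
      refine ⟨(a + b) / 2, mem_interior.2 ⟨Ioo a b, Ioo_subset_Icc_self.trans (hI.out ha hb),
        isOpen_Ioo, ?_⟩⟩
      constructor <;> linarith
    exact hg.continuousOn_derivWithin (uniqueDiffOn_convex hI.convex hint) le_rfl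

theorem isKatoFamily_of_isSelfAdjoint {ℋ : Type*} [NormedAddCommGroup ℋ] [InnerProductSpace ℂ ℋ]
    [CompleteSpace ℋ] {n : ℕ} {D : Submodule ℂ ℋ} {H : Fin n → D →ₗ[ℂ] ℋ} {I : Set ℝ}
    (hI : I.OrdConnected) {f : Fin n → ℝ → ℝ}
    (hsa : ∀ t ∈ I, IsSelfAdjoint (linearCombinationHamiltonian D H f t))
    (hf : ∀ i, ContDiffOn ℝ 1 (f i) I)
    (hbound : ∀ i, ∃ K : ℝ, 0 < K ∧ ∀ t ∈ I, ∀ Ψ : D,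
      ‖H i Ψ‖ ≤ K * (‖(linearCombinationHamiltonian D H f t) Ψ‖ + ‖(Ψ : ℋ)‖)) :
    IsKatoFamily H f I where
  ordConnected := hI
  selfAdjoint t ht := (hsa t ht).isSelfAdjointOn
  hasDeriv i t ht := ((hf i).differentiableOn one_ne_zero t ht).hasDerivWithinAt
  continuous_deriv i := continuousOn_derivWithin_of_contDiffOn_one hI (hf i)
  bound := hbound

theorem mainTheorem3 {ℋ : Type*} [NormedAddCommGroup ℋ] [InnerProductSpace ℂ ℋ] [CompleteSpace ℋ]
    (n : ℕ) (D : Submodule ℂ ℋ) (H : Fin n → D →ₗ[ℂ] ℋ)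
    (hD : Dense (D : Set ℋ)) (hsymm : ∀ i, IsSymmetricOperatorOn D (H i))
    (I : Set ℝ) (hI : I.OrdConnected) (f : Fin n → ℝ → ℝ)
    (hsa : ∀ t ∈ I, IsSelfAdjoint (linearCombinationHamiltonian D H f t))
    (hf : ∀ i, ContDiffOn ℝ 1 (f i) I)
    (hbound : ∀ i, ∃ K : ℝ, 0 < K ∧ ∀ t ∈ I, ∀ Ψ : D,
      ‖H i Ψ‖ ≤ K * (‖(linearCombinationHamiltonian D H f t) Ψ‖ + ‖(Ψ : ℋ)‖)) :
    ∃ U : ℝ → ℝ → (ℋ ≃ₗᵢ[ℂ] ℋ),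
      IsUnitaryPropagator I U ∧
      IsStronglyDifferentiable I D U ∧
      ∀ s ∈ I, ∀ Ψs ∈ D,
        SolvesSchrodinger I (linearCombinationHamiltonian D H f) (fun t => U t s Ψs) ∧
        U s s Ψs = Ψs := by
  have hH := isKatoFamily_of_isSelfAdjoint hI hsa hf hbound
  obtain ⟨u, U, hU⟩ := hH.exists_isYosidaLimit
  refine ⟨hU.unitary hH, ⟨?_, ?_, ?_⟩, ?_, ?_⟩
  · intro r hr s hs t ht x
    rw [hU.unitary_apply hH ht hs, hU.unitary_apply hH hs hr, hU.unitary_apply hH ht hr,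
      hU.comp_apply hH ht hs hr]
  · intro t ht x
    rw [hU.unitary_apply hH ht ht, hU.refl ht]
  · intro x
    exact (hU.continuousOn_prod hH x).congr fun p hp => hU.unitary_apply hH hp.2 hp.1 x
  · intro y hy
    exact (hU.differentiableOn_prod hH ⟨y, hy⟩).congr fun p hp => hU.unitary_apply hH hp.2 hp.1 y
  · intro s hs y hy
    refine ⟨fun t ht => ?_, by rw [hU.unitary_apply hH hs hs, hU.refl hs]⟩
    have hmem : hU.unitary hH t s y ∈ D := by
      rw [hU.unitary_apply hH hs ht]
      exact hU.mem_domain hH hs ht ⟨y, hy⟩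
    refine ⟨hmem, ?_⟩
    have h1 := (hU.hasDerivWithinAt_left hH hs ht ⟨y, hy⟩).congr
      (fun r hr => hU.unitary_apply hH hs hr y) (hU.unitary_apply hH hs ht y)
    convert h1 using 1
    rw [neg_smul]
    congr 2
    change hamiltonianMap H f t ⟨_, hmem⟩ = _
    congr 2
    exact hU.unitary_apply hH hs ht y
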